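/- **Second fundamental form of the surface swept out by the $G_2$-binormal motion.** Let $\times$ be the cross product $x\times y=\tfrac12(\bar y x-\bar x y)$ on $\mathrm{Im}(\mathbb O)\cong\mathbb R^7$, where the octonions $\mathbb O=\mathbb H\oplus\mathbb H l$ carry the product $(a+bl)(c+dl)=(ac-\bar d b)+(da+b\bar c)l$. Let $J\subset\mathbb R$ be open, $I\subset\mathbb R$ an open interval, $s_0\in I$, and let $\gamma:J\times I\to\mathrm{Im}(\mathbb O)$, $(t,s)\mapsto\gamma(t,s)$, be smooth with $|\gamma_s|=1$ and $$\gamma_t=\gamma_s\times\gamma_{ss}.$$ Put $k_1=|\gamma_{ss}|$, and, where these make sense, $$I_4=\gamma_s,\quad I_1=\tfrac1{k_1}I_{4s},\quad I_5=I_1\times I_4,\quad I_2=\tfrac1{\kappa_2}\bigl(I_{1s}-\langle I_{1s},I_4\rangle I_4-\langle I_{1s},I_5\rangle I_5\bigr),$$ $$I_3=I_1\times I_2,\quad I_6=I_2\times I_4,\quad I_7=I_3\times I_4,\qquad \kappa_2=\sqrt{|I_{1s}|^2-\langle I_{1s},I_4\rangle^2-\langle I_{1s},I_5\rangle^2},$$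 and assume $k_1>0$ and $\kappa_2>0$ on $J\times I$. Let $\rho_1=\langle I_{1s},I_5\rangle$, $\rho_2=\langle I_{2s},I_6\rangle$, $\alpha=\langle I_{2s},I_3\rangle$, $\beta_1=\langle I_{2s},I_7\rangle$, $\beta_2=\langle I_{3s},I_6\rangle$, $$r=\tfrac1{\sqrt2}e^{-\sqrt{-1}\int_{s_0}^s\rho_1},\qquad q=\tfrac1{\sqrt2}e^{-\sqrt{-1}\int_{s_0}^s\rho_2},$$ $$\varphi_1=k_1\bar r,\qquad \varphi_2=2\kappa_2 r\bar q,\qquad \varphi_3=-\sqrt2\,q^2r\,[2\alpha+\sqrt{-1}(\beta_1+\beta_2)].$$ Let $\Sigma$ be the surface parametrised by $\gamma$, and $E_1=I_4$, $E_2=-I_5$, $E_3=I_1$, $E_4=I_2$, $E_5=I_6$, $E_6=I_3$, $E_7=I_7$. Then $(E_1,\dots,E_7)$ is orthonormal, and $E_1,E_2$ span the tangent plane of $\Sigma$. Let $\omega^j=\langle d\gamma,E_j\rangle$ and $\omega_i^\alpha=\langle dE_i,E_\alpha\rangle$ ($i,j\in\{1,2\}$, $3\le\alpha\le7$). The coefficients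 $h^\alpha_{ij}$ of the second fundamental form, defined by $\omega_i^\alpha=\sum_j h^\alpha_{ij}\omega^j$, exist, are symmetric in $i,j$, and are given by $$h^3_{11}=\sqrt2|\varphi_1|,\qquad h^3_{12}=h^3_{21}=\frac{\sqrt{-1}}{2}\Bigl(\ln\frac{\bar\varphi_1}{\varphi_1}\Bigr)_s,$$ $$h^3_{22}=-\frac{\varphi_1\bar\varphi_{1ss}+\bar\varphi_1\varphi_{1ss}}{2\sqrt2|\varphi_1|^3}+\frac{|\varphi_2|^2}{\sqrt2|\varphi_1|},\qquad h^4_{22}=-\frac{2(\ln|\varphi_1|)_s|\varphi_2|+(|\varphi_2|)_s}{\sqrt2|\varphi_1|},$$ $$h^5_{12}=h^5_{21}=-|\varphi_2|,\qquad h^5_{22}=-\frac{\sqrt{-1}\,\bigl[2(\ln\frac{\bar\varphi_1}{\varphi_1})_s|\varphi_2|^2+\varphi_2\bar\varphi_{2s}-\bar\varphi_2\varphi_{2s}\bigr]}{2\sqrt2|\varphi_1||\varphi_2|},$$ $$h^6_{22}=\frac{\varphi_1^3\varphi_2^2\varphi_3+\bar\varphi_1^3\bar\varphi_2^2\bar\varphi_3}{2\sqrt2|\varphi_1|^4|\varphi_2|},\qquad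 h^7_{22}=\frac{\sqrt{-1}(\bar\varphi_1^3\bar\varphi_2^2\bar\varphi_3-\varphi_1^3\varphi_2^2\varphi_3)}{2\sqrt2|\varphi_1|^4|\varphi_2|}-\frac{3|\varphi_2|}2,$$ all other $h^\alpha_{ij}$ being zero. Here $(\ln f)_s$ denotes the logarithmic derivative $f_s/f$. -/

import Mathlib

open scoped Quaternion ContDiff ComplexConjugate RealInnerProductSpace

noncomputable section

/-! ### Octonions and the cross product on `Im 𝕆 = ℝ⁷` -/

/-- The octonions, as the Cayley-Dickson double of the quaternions: `⟨a, b⟩` stands for `a + b l`. -/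
@[ext] structure Octonion where
  fst : ℍ[ℝ]
  snd : ℍ[ℝ]

namespace Octonion

instance : One Octonion := ⟨⟨1, 0⟩⟩
instance : Add Octonion := ⟨fun x y => ⟨x.fst + y.fst, x.snd + y.snd⟩⟩
instance : Sub Octonion := ⟨fun x y => ⟨x.fst - y.fst, x.snd - y.snd⟩⟩
instance : SMul ℝ Octonion := ⟨fun r x => ⟨r • x.fst, r • x.snd⟩⟩

/-- Octonion conjugation: `a + b l ↦ ā - b l`. -/
instance : Star Octonion := ⟨fun x => ⟨star x.fst, -x.snd⟩⟩

/-- `(a + b l)(c + d l) = (a c - d̄ b) + (d a + b c̄) l`; this gives the usual rules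
`a (b l) = (b a) l`, `(a l) b = (a b̄) l`, `(a l)(b l) = - b̄ a`. -/
instance : Mul Octonion :=
  ⟨fun x y => ⟨x.fst * y.fst - star y.snd * x.snd, y.snd * x.fst + x.snd * star y.fst⟩⟩

/-- The octonion cross product `x × y = (ȳ x - x̄ y) / 2`. -/
def cross (x y : Octonion) : Octonion := (1 / 2 : ℝ) • (star y * x - star x * y)

end Octonion

/-- The imaginary octonions, identified with Euclidean `ℝ⁷` through the orthonormal basis
`i, j, k, l, il, jl, kl`. -/
abbrev ImOctonion : Type := EuclideanSpace ℝ (Fin 7)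

namespace ImOctonion

/-- The inclusion `Im 𝕆 → 𝕆`. -/
def toOctonion (x : ImOctonion) : Octonion :=
  ⟨⟨0, x 0, x 1, x 2⟩, ⟨x 3, x 4, x 5, x 6⟩⟩

/-- The imaginary part of an octonion. -/
def ofOctonion (z : Octonion) : ImOctonion :=
  !₂[z.fst.imI, z.fst.imJ, z.fst.imK, z.snd.re, z.snd.imI, z.snd.imJ, z.snd.imK]

/-- The cross product on `Im 𝕆 = ℝ⁷` induced by the octonions. -/
def cross (x y : ImOctonion) : ImOctonion :=
  ofOctonion (Octonion.cross x.toOctonion y.toOctonion)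

/-- The octonion cross product of imaginary octonions is imaginary, so `cross` forgets nothing. -/
theorem toOctonion_cross (x y : ImOctonion) :
    (cross x y).toOctonion = Octonion.cross x.toOctonion y.toOctonion := by
  have h : ∀ z : Octonion, z.fst.re = 0 → (ofOctonion z).toOctonion = z := by
    intro z hz
    ext <;> simp [ofOctonion, toOctonion, hz]
  apply h
  change (1 / 2 : ℝ) * ((star y.toOctonion * x.toOctonion).fst.re
    - (star x.toOctonion * y.toOctonion).fst.re) = 0
  have e : ∀ a b : ImOctonion, (star a.toOctonion * b.toOctonion).fst.re
      = a 0 * b 0 + a 1 * b 1 + a 2 * b 2 + a 3 * b 3 + a 4 * b 4 + a 5 * b 5 + a 6 * b 6 := by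
    intro a b
    have e₁ : ∀ u v : ℍ[ℝ], (star u * v).re
        = u.re * v.re + u.imI * v.imI + u.imJ * v.imJ + u.imK * v.imK := by
      intro u v
      simp
    have e₂ : (star a.toOctonion * b.toOctonion).fst.re = (star a.toOctonion.fst * b.toOctonion.fst).re
        - (star b.toOctonion.snd * (-a.toOctonion.snd)).re := rfl
    rw [e₂, mul_neg, Quaternion.re_neg, e₁, e₁]
    simp only [toOctonion]
    ring
  rw [e, e]
  ring

end ImOctonion

open ImOctonion (cross)

/-! ### The `G₂`-frame and the complex invariants of a curve `c` in `Im 𝕆` -/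

namespace G2Curve

variable (c : ℝ → ImOctonion)

/-- `I₄ = c'`. -/
def I4 (s : ℝ) : ImOctonion := deriv c s

/-- `k₁ = ‖c''‖`. -/
def k1 (s : ℝ) : ℝ := ‖deriv (I4 c) s‖

def I1 (s : ℝ) : ImOctonion := (k1 c s)⁻¹ • deriv (I4 c) s

def I5 (s : ℝ) : ImOctonion := cross (I1 c s) (I4 c s)

def kappa2 (s : ℝ) : ℝ :=
  √(‖deriv (I1 c) s‖ ^ 2 - ⟪deriv (I1 c) s, I4 c s⟫ ^ 2 - ⟪deriv (I1 c) s, I5 c s⟫ ^ 2)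

def I2 (s : ℝ) : ImOctonion :=
  (kappa2 c s)⁻¹ • (deriv (I1 c) s - ⟪deriv (I1 c) s, I4 c s⟫ • I4 c s
    - ⟪deriv (I1 c) s, I5 c s⟫ • I5 c s)

def I3 (s : ℝ) : ImOctonion := cross (I1 c s) (I2 c s)

def I6 (s : ℝ) : ImOctonion := cross (I2 c s) (I4 c s)

def I7 (s : ℝ) : ImOctonion := cross (I3 c s) (I4 c s)

def rho1 (s : ℝ) : ℝ := ⟪deriv (I1 c) s, I5 c s⟫

def rho2 (s : ℝ) : ℝ := ⟪deriv (I2 c) s, I6 c s⟫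

def alpha (s : ℝ) : ℝ := ⟪deriv (I2 c) s, I3 c s⟫

def beta1 (s : ℝ) : ℝ := ⟪deriv (I2 c) s, I7 c s⟫

def beta2 (s : ℝ) : ℝ := ⟪deriv (I3 c) s, I6 c s⟫

variable (s₀ : ℝ)

/-- `r = exp (-√-1 ∫ ρ₁) / √2`, the integral being taken from the base point `s₀`. -/
def r (s : ℝ) : ℂ :=
  1 / (√2 : ℝ) * Complex.exp (-Complex.I * ((∫ x in s₀..s, rho1 c x : ℝ) : ℂ))

/-- `q = exp (-√-1 ∫ ρ₂) / √2`, the integral being taken from the base point `s₀`. -/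
def q (s : ℝ) : ℂ :=
  1 / (√2 : ℝ) * Complex.exp (-Complex.I * ((∫ x in s₀..s, rho2 c x : ℝ) : ℂ))

def phi1 (s : ℝ) : ℂ := k1 c s * conj (r c s₀ s)

def phi2 (s : ℝ) : ℂ := 2 * kappa2 c s * r c s₀ s * conj (q c s₀ s)

def phi3 (s : ℝ) : ℂ :=
  -(√2 : ℝ) * q c s₀ s ^ 2 * r c s₀ s * (2 * alpha c s + Complex.I * (beta1 c s + beta2 c s))

end G2Curve

/-! ### The swept surface `(t, s) ↦ γ t s`, its adapted frame and its second fundamental form -/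

namespace G2Surface

variable (γ : ℝ → ℝ → ImOctonion)

/-- The adapted frame `E₁, …, E₇` at the parameter point `p = (t, s)`
(indices outside `1, …, 7` are not used). -/
def E : ℕ → ℝ × ℝ → ImOctonion
  | 1, p => G2Curve.I4 (γ p.1) p.2
  | 2, p => -G2Curve.I5 (γ p.1) p.2
  | 3, p => G2Curve.I1 (γ p.1) p.2
  | 4, p => G2Curve.I2 (γ p.1) p.2
  | 5, p => G2Curve.I6 (γ p.1) p.2
  | 6, p => G2Curve.I3 (γ p.1) p.2
  | 7, p => G2Curve.I7 (γ p.1) p.2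
  | _, _ => 0

/-- The differential `dγ` of the parametrisation. -/
def dGamma (p : ℝ × ℝ) : ℝ × ℝ →L[ℝ] ImOctonion := fderiv ℝ (fun x : ℝ × ℝ => γ x.1 x.2) p

/-- The coframe form `ωʲ`, the `E_j`-component of `dγ`. -/
def coframe (j : ℕ) (p X : ℝ × ℝ) : ℝ := ⟪dGamma γ p X, E γ j p⟫

/-- The connection form `ω_i^a`, the `E_a`-component of `dE_i`. -/
def connForm (i a : ℕ) (p X : ℝ × ℝ) : ℝ := ⟪fderiv ℝ (E γ i) p X, E γ a p⟫

/-- The vector fields on the parameter domain that `dγ` maps to `E₁` and `E₂`: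
`e₁ = ∂/∂s` and `e₂ = k₁⁻¹ ∂/∂t`. -/
def e : ℕ → ℝ × ℝ → ℝ × ℝ
  | 1, _ => (0, 1)
  | 2, p => ((G2Curve.k1 (γ p.1) p.2)⁻¹, 0)
  | _, _ => 0

/-- The coefficient `h^a_{ij}` of the second fundamental form: the coefficient of `ωʲ` in
`ω_i^a`, that is `ω_i^a(e_j)`. -/
def h (a i j : ℕ) (p : ℝ × ℝ) : ℝ := connForm γ i a p (e γ j p)

end G2Surface

end

open ImOctonion (cross)

/-! ### Algebra of the cross product -/

namespace ImOctonion

/-! The flow equation turns every time derivative into an `s`-derivative, so the second fundamental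
form at `(t, s)` is computed from the single curve `γ t`. Write `v = γ_s × γ_ss`. Then `γ_t = v =
-k₁ I₅ = k₁ E₂`, hence `e₁ = ∂/∂s` and `e₂ = k₁⁻¹ ∂/∂t` are dual to `ω¹, ω²`, and the coefficients
are `h^a_{ij} = ⟨dE_i(e_j), E_a⟩`.

Partial derivatives commute, so `∂_t γ_s = v_s` and `∂_t γ_ss = v_ss`. As `E₁ = γ_s` and `E₂ = k₁⁻¹
γ_s × γ_ss`, the derivatives needed are `γ_ss`, `v_s`, `-I₅_s` and, modulo the tangential direction
`I₅`, `k₁⁻¹ (v_s × γ_ss + γ_s × v_ss)`. The last one gives `h^a_22 = ⟨acceleration, E_a⟩ / k₁²`.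

These vectors are resolved in the `G₂`-frame. Its orthonormality (`IsBasicTriple.orthonormal`) and
its structure equations come from two properties of the cross product: `⟨x × y, z⟩` is alternating,
and `(x × y) × z` symmetrised in `y, z` is a combination of `x, y, z` (`cross_cross_add`). The
relation `beta2_eq` is one of their consequences.

Finally `φ₁` has modulus `k₁/√2` and phase `∫ρ₁`, `φ₂` has modulus `κ₂` and phase `∫ρ₂ - ∫ρ₁`, while
`φ₃` carries the phase `-2∫ρ₂ - ∫ρ₁`. Each expression in the theorem involves only moduli,
derivatives of phases, or products whose phases cancel, so it reduces to a rational expression in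
`k₁, κ₂, ρ₁, ρ₂, α, β₁` and derivatives, matching the frame computation. -/

theorem cross_eq (x y : ImOctonion) : cross x y = !₂[
    (x 1 * y 2 - x 2 * y 1) + (x 3 * y 4 - x 4 * y 3) + (x 6 * y 5 - x 5 * y 6),
    (x 2 * y 0 - x 0 * y 2) + (x 3 * y 5 - x 5 * y 3) + (x 4 * y 6 - x 6 * y 4),
    (x 0 * y 1 - x 1 * y 0) + (x 3 * y 6 - x 6 * y 3) + (x 5 * y 4 - x 4 * y 5),
    (x 4 * y 0 - x 0 * y 4) + (x 5 * y 1 - x 1 * y 5) + (x 6 * y 2 - x 2 * y 6),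
    (x 0 * y 3 - x 3 * y 0) + (x 6 * y 1 - x 1 * y 6) + (x 2 * y 5 - x 5 * y 2),
    (x 0 * y 6 - x 6 * y 0) + (x 1 * y 3 - x 3 * y 1) + (x 4 * y 2 - x 2 * y 4),
    (x 5 * y 0 - x 0 * y 5) + (x 1 * y 4 - x 4 * y 1) + (x 2 * y 3 - x 3 * y 2)] := by
  have hc : Octonion.cross x.toOctonion y.toOctonion
      = ⟨(1 / 2 : ℝ) • ((star y.toOctonion.fst * x.toOctonion.fst
            - star x.toOctonion.snd * -y.toOctonion.snd)
          - (star x.toOctonion.fst * y.toOctonion.fst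
            - star y.toOctonion.snd * -x.toOctonion.snd)),
        (1 / 2 : ℝ) • ((x.toOctonion.snd * star y.toOctonion.fst
            + -y.toOctonion.snd * star x.toOctonion.fst)
          - (y.toOctonion.snd * star x.toOctonion.fst
            + -x.toOctonion.snd * star y.toOctonion.fst))⟩ := rfl
  rw [cross, hc]
  ext i
  fin_cases i <;> simp [ofOctonion] <;> simp [toOctonion] <;> ring

theorem inner_eq (x y : ImOctonion) : ⟪x, y⟫ =
    x 0 * y 0 + x 1 * y 1 + x 2 * y 2 + x 3 * y 3 + x 4 * y 4 + x 5 * y 5 + x 6 * y 6 := by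
  simp [PiLp.inner_apply, Fin.sum_univ_succ]
  ring

theorem cross_add_left (x x' y : ImOctonion) : cross (x + x') y = cross x y + cross x' y := by
  ext i
  fin_cases i <;> simp [cross_eq] <;> ring

theorem cross_smul_left (a : ℝ) (x y : ImOctonion) : cross (a • x) y = a • cross x y := by
  ext i
  fin_cases i <;> simp [cross_eq] <;> ring

theorem cross_swap (x y : ImOctonion) : cross y x = -cross x y := by
  ext i
  fin_cases i <;> simp [cross_eq] <;> ring

theorem cross_add_right (x y y' : ImOctonion) : cross x (y + y') = cross x y + cross x y' := by
  rw [cross_swap, cross_add_left, cross_swap x y, cross_swap x y']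
  abel

theorem cross_smul_right (a : ℝ) (x y : ImOctonion) : cross x (a • y) = a • cross x y := by
  rw [cross_swap, cross_smul_left, cross_swap x y]
  simp

theorem cross_self (x : ImOctonion) : cross x x = 0 := by
  ext i
  fin_cases i <;> simp [cross_eq] <;> ring

theorem cross_neg_left (x y : ImOctonion) : cross (-x) y = -cross x y := by
  simpa using cross_smul_left (-1) x y

/-- Part of the statement that `⟨x × y, z⟩` is an alternating 3-form, the form stabilised by `G₂`.
-/
theorem inner_cross_swap (x y z : ImOctonion) : ⟪cross x y, z⟫ = -⟪cross x z, y⟫ := by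
  simp only [inner_eq, cross_eq]
  simp
  ring

theorem inner_cross_cycle (x y z : ImOctonion) : ⟪cross x y, z⟫ = ⟪x, cross y z⟫ := by
  simp only [inner_eq, cross_eq]
  simp
  ring

theorem inner_cross_left (x y : ImOctonion) : ⟪cross x y, x⟫ = 0 := by
  rw [inner_cross_swap, cross_self, inner_zero_left, neg_zero]

theorem inner_cross_right (x y : ImOctonion) : ⟪cross x y, y⟫ = 0 := by
  rw [inner_cross_cycle, cross_self, inner_zero_right]

/-- Polarisation of the double cross product identity. In dimension 7 only this symmetrisation in
`y, z` reduces to inner products; `(x × y) × z` by itself need not lie in the span of `x, y, z`. -/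
theorem cross_cross_add (x y z : ImOctonion) :
    cross (cross x y) z + cross (cross x z) y
      = -(2 * ⟪y, z⟫) • x + ⟪x, y⟫ • z + ⟪x, z⟫ • y := by
  ext i
  fin_cases i <;> simp [cross_eq, inner_eq] <;> ring

theorem cross_cross_self (x y : ImOctonion) :
    cross (cross x y) y = -⟪y, y⟫ • x + ⟪x, y⟫ • y := by
  have h := cross_cross_add x y y
  rw [← two_smul ℝ, add_assoc, ← two_smul ℝ, ← sub_eq_zero] at h
  have h2 : (2 : ℝ) • (cross (cross x y) y - (-⟪y, y⟫ • x + ⟪x, y⟫ • y)) = 0 := by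
    rw [← h]
    module
  exact sub_eq_zero.1 ((smul_eq_zero.1 h2).resolve_left two_ne_zero)

theorem inner_cross_cross (x y z : ImOctonion) :
    ⟪cross x z, cross y z⟫ = ⟪z, z⟫ * ⟪x, y⟫ - ⟪x, z⟫ * ⟪y, z⟫ := by
  rw [inner_cross_cycle, cross_swap (cross y z), cross_cross_self, inner_neg_right,
    inner_add_right, inner_smul_right, inner_smul_right]
  ring

/-- The cross product as a continuous bilinear map. -/
noncomputable def crossL : ImOctonion →L[ℝ] ImOctonion →L[ℝ] ImOctonion :=
  LinearMap.toContinuousLinearMap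
    ((LinearMap.toContinuousLinearMap : (ImOctonion →ₗ[ℝ] ImOctonion) ≃ₗ[ℝ] _).toLinearMap ∘ₗ
      LinearMap.mk₂ ℝ cross cross_add_left cross_smul_left cross_add_right cross_smul_right)

theorem crossL_apply (x y : ImOctonion) : crossL x y = cross x y := rfl

theorem _root_.HasDerivAt.octonionCross {f g : ℝ → ImOctonion} {f' g' : ImOctonion} {s : ℝ}
    (hf : HasDerivAt f f' s) (hg : HasDerivAt g g' s) :
    HasDerivAt (fun x => cross (f x) (g x)) (cross f' (g s) + cross (f s) g') s := by
  have := (crossL.hasFDerivAt.comp_hasDerivAt s hf).clm_apply hg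
  simpa [crossL_apply] using this

theorem _root_.HasFDerivAt.octonionCross {X : Type*} [NormedAddCommGroup X] [NormedSpace ℝ X]
    {f g : X → ImOctonion} {f' g' : X →L[ℝ] ImOctonion} {p : X}
    (hf : HasFDerivAt f f' p) (hg : HasFDerivAt g g' p) :
    ∃ D : X →L[ℝ] ImOctonion, HasFDerivAt (fun x => cross (f x) (g x)) D p ∧
      ∀ v, D v = cross (f' v) (g p) + cross (f p) (g' v) := by
  refine ⟨_, (crossL.hasFDerivAt.comp p hf).clm_apply hg, fun v => ?_⟩
  simp [crossL_apply, add_comm]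

theorem _root_.ContDiffOn.octonionCross {X : Type*} [NormedAddCommGroup X] [NormedSpace ℝ X]
    {n : WithTop ℕ∞} {f g : X → ImOctonion} {U : Set X}
    (hf : ContDiffOn ℝ n f U) (hg : ContDiffOn ℝ n g U) :
    ContDiffOn ℝ n (fun x => cross (f x) (g x)) U :=
  (crossL.contDiff.comp_contDiffOn hf).clm_apply hg

end ImOctonion

/-! ### Orthonormal frames generated by a triple -/

namespace ImOctonion

theorem inner_cross_cross_left (x y z : ImOctonion) :
    ⟪cross z x, cross z y⟫ = ⟪z, z⟫ * ⟪x, y⟫ - ⟪x, z⟫ * ⟪y, z⟫ := by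
  rw [cross_swap x z, cross_swap y z, inner_neg_neg, inner_cross_cross]

/-- Three orthonormal vectors `a, b, d` with `b` orthogonal to `a × d`: they generate an adapted
orthonormal frame of `Im 𝕆`. -/
structure IsBasicTriple (a b d : ImOctonion) : Prop where
  aa : ⟪a, a⟫ = 1
  bb : ⟪b, b⟫ = 1
  dd : ⟪d, d⟫ = 1
  ab : ⟪a, b⟫ = 0
  ad : ⟪a, d⟫ = 0
  bd : ⟪b, d⟫ = 0
  adb : ⟪cross a d, b⟫ = 0

namespace IsBasicTriple

variable {a b d : ImOctonion}

theorem cross_ad_d (h : IsBasicTriple a b d) : cross (cross a d) d = -a := by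
  simp [-inner_self_eq_norm_sq_to_K, cross_cross_self, h.dd, h.ad]

theorem cross_bd_d (h : IsBasicTriple a b d) : cross (cross b d) d = -b := by
  simp [-inner_self_eq_norm_sq_to_K, cross_cross_self, h.dd, h.bd]

theorem inner_ab_d (h : IsBasicTriple a b d) : ⟪cross a b, d⟫ = 0 := by
  rw [inner_cross_swap, h.adb, neg_zero]

theorem cross_abd_d (h : IsBasicTriple a b d) :
    cross (cross (cross a b) d) d = -cross a b := by
  simp [-inner_self_eq_norm_sq_to_K, cross_cross_self, h.dd, h.inner_ab_d]

theorem cross_a_ad (h : IsBasicTriple a b d) : cross a (cross a d) = -d := by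
  rw [cross_swap, cross_swap d a, cross_neg_left, neg_neg, cross_cross_self, h.aa,
    real_inner_comm, h.ad]
  simp

/-- For pairwise orthogonal vectors the right side of `cross_cross_add` vanishes, so exchanging the
last two factors of a double product changes its sign. -/
theorem cross_a_bd (h : IsBasicTriple a b d) :
    cross a (cross b d) = -cross (cross a b) d := by
  have h1 := cross_cross_add b d a
  rw [real_inner_comm, h.ad, h.bd, real_inner_comm, h.ab] at h1
  rw [cross_swap (cross b d) a, cross_swap b a, cross_neg_left, neg_neg,
    eq_neg_of_add_eq_zero_left (h1.trans (by simp)), neg_neg]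

/-- The adapted frame `d, a × d, a, b, b × d, a × b, (a × b) × d` is orthonormal. -/
theorem orthonormal (h : IsBasicTriple a b d) :
    Orthonormal ℝ ![d, cross a d, a, b, cross b d, cross a b, cross (cross a b) d] := by
  have ab_a : cross a (cross a b) = -b := by
    rw [cross_swap, cross_swap b a, cross_neg_left, neg_neg, cross_cross_self, h.aa,
      real_inner_comm, h.ab]
    simp
  have ab_b : cross b (cross a b) = a := by
    rw [cross_swap, cross_cross_self, h.bb, h.ab]
    simp
  -- `eij` pairs the entries `i` and `j` of the list, counted from 0. The pairs without such a name
  -- are the hypotheses of the triple.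
  have e01 : ⟪d, cross a d⟫ = 0 := (real_inner_comm _ _).trans (inner_cross_right a d)
  have e02 : ⟪d, a⟫ = 0 := (real_inner_comm _ _).trans h.ad
  have e03 : ⟪d, b⟫ = 0 := (real_inner_comm _ _).trans h.bd
  have e04 : ⟪d, cross b d⟫ = 0 := (real_inner_comm _ _).trans (inner_cross_right b d)
  have e05 : ⟪d, cross a b⟫ = 0 := (real_inner_comm _ _).trans h.inner_ab_d
  have e06 : ⟪d, cross (cross a b) d⟫ = 0 :=
    (real_inner_comm _ _).trans (inner_cross_right (cross a b) d)
  have e11 : ⟪cross a d, cross a d⟫ = 1 := by simp [-inner_self_eq_norm_sq_to_K, inner_cross_cross, h.aa, h.dd, h.ad]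
  have e12 := inner_cross_left a d
  have e14 : ⟪cross a d, cross b d⟫ = 0 := by simp [-inner_self_eq_norm_sq_to_K, inner_cross_cross, h.ab, h.ad]
  have e15 : ⟪cross a d, cross a b⟫ = 0 := by simp [-inner_self_eq_norm_sq_to_K, inner_cross_cross_left, e02, e03]
  have e25 : ⟪a, cross a b⟫ = 0 := (real_inner_comm _ _).trans (inner_cross_left a b)
  have e35 : ⟪b, cross a b⟫ = 0 := (real_inner_comm _ _).trans (inner_cross_right a b)
  have e16 : ⟪cross a d, cross (cross a b) d⟫ = 0 := by simp [-inner_self_eq_norm_sq_to_K, inner_cross_cross, e25, h.ad]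
  have e24 : ⟪a, cross b d⟫ = 0 := by rw [← inner_cross_cycle, h.inner_ab_d]
  have e26 : ⟪a, cross (cross a b) d⟫ = 0 := by simp [← inner_cross_cycle, ab_a, h.bd]
  have e34 : ⟪b, cross b d⟫ = 0 := (real_inner_comm _ _).trans (inner_cross_left b d)
  have e36 : ⟪b, cross (cross a b) d⟫ = 0 := by rw [← inner_cross_cycle, ab_b, h.ad]
  have e44 : ⟪cross b d, cross b d⟫ = 1 := by simp [-inner_self_eq_norm_sq_to_K, inner_cross_cross, h.bb, h.dd, h.bd]
  have e45 : ⟪cross b d, cross a b⟫ = 0 := by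
    rw [cross_swap b a, inner_neg_right, inner_cross_cross_left, e02, e03]
    simp
  have e46 : ⟪cross b d, cross (cross a b) d⟫ = 0 := by simp [-inner_self_eq_norm_sq_to_K, inner_cross_cross, e35, h.bd]
  have e55 : ⟪cross a b, cross a b⟫ = 1 := by simp [-inner_self_eq_norm_sq_to_K, inner_cross_cross, h.aa, h.bb, h.ab]
  have e56 : ⟪cross a b, cross (cross a b) d⟫ = 0 :=
    (real_inner_comm _ _).trans (inner_cross_left (cross a b) d)
  have e66 : ⟪cross (cross a b) d, cross (cross a b) d⟫ = 1 := by
    simp [-inner_self_eq_norm_sq_to_K, inner_cross_cross, e55, h.dd, h.inner_ab_d]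
  rw [orthonormal_iff_ite]
  have key : ∀ i j : Fin 7, i ≤ j → ⟪(![d, cross a d, a, b, cross b d, cross a b,
      cross (cross a b) d] : Fin 7 → ImOctonion) i, (![d, cross a d, a, b, cross b d, cross a b,
      cross (cross a b) d] : Fin 7 → ImOctonion) j⟫ = if i = j then 1 else 0 := by
    intro i j hij
    fin_cases i <;> fin_cases j <;> first
      | exact absurd hij (by decide)
      | simp [-inner_self_eq_norm_sq_to_K, h.aa, h.bb, h.dd, h.ab, h.adb, e01, e02, e03, e04, e05,
          e06, e11, e12, e14, e15, e16, e24, e25, e26, e34, e35, e36, e44, e45, e46, e55, e56, e66]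
  intro i j
  rcases le_total i j with hij | hij
  · exact key i j hij
  · rw [real_inner_comm, key j i hij]
    simp only [eq_comm]

end IsBasicTriple

end ImOctonion

/-! ### Structure equations of the frame along a curve -/

theorem ContDiffOn.hasDerivAt_of_isOpen {F : Type*} [NormedAddCommGroup F] [NormedSpace ℝ F]
    {f : ℝ → F} {I : Set ℝ} (hf : ContDiffOn ℝ ∞ f I) (hI : IsOpen I) {s : ℝ} (hs : s ∈ I) :
    HasDerivAt f (deriv f s) s :=
  ((hf.contDiffAt (hI.mem_nhds hs)).differentiableAt (by simp)).hasDerivAt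

theorem ContDiffOn.deriv_infty {F : Type*} [NormedAddCommGroup F] [NormedSpace ℝ F]
    {f : ℝ → F} {I : Set ℝ} (hf : ContDiffOn ℝ ∞ f I) (hI : IsOpen I) :
    ContDiffOn ℝ ∞ (deriv f) I :=
  hf.deriv_of_isOpen hI (by simp)

/-- Skew-symmetry of the connection matrix of a moving frame: differentiate a constant inner
product. -/
theorem inner_deriv_eq_neg {f g : ℝ → ImOctonion} {I : Set ℝ} (hI : IsOpen I)
    (hf : ContDiffOn ℝ ∞ f I) (hg : ContDiffOn ℝ ∞ g I) {a : ℝ}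
    (h : ∀ x ∈ I, ⟪f x, g x⟫ = a) {s : ℝ} (hs : s ∈ I) :
    ⟪deriv f s, g s⟫ = -⟪deriv g s, f s⟫ := by
  have h1 := (hf.hasDerivAt_of_isOpen hI hs).inner ℝ (hg.hasDerivAt_of_isOpen hI hs)
  have h2 : HasDerivAt (fun x => ⟪f x, g x⟫) 0 s :=
    (hasDerivAt_const s a).congr_of_eventuallyEq
      (Filter.eventually_of_mem (hI.mem_nhds hs) h)
  have h3 := h1.unique h2
  rw [real_inner_comm (deriv g s)] at h3
  linarith

namespace G2Curve

/-- A unit speed curve whose frame is defined on the open set `I`. -/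
structure IsRegularOn (c : ℝ → ImOctonion) (I : Set ℝ) : Prop where
  isOpen : IsOpen I
  smooth : ContDiffOn ℝ ∞ c I
  norm_deriv : ∀ s ∈ I, ‖deriv c s‖ = 1
  k1_pos : ∀ s ∈ I, 0 < k1 c s
  kappa2_pos : ∀ s ∈ I, 0 < kappa2 c s

/-- The frame in the order `I₄, I₅, I₁, I₂, I₆, I₃, I₇`. -/
noncomputable def frame (c : ℝ → ImOctonion) (s : ℝ) : Fin 7 → ImOctonion :=
  ![I4 c s, I5 c s, I1 c s, I2 c s, I6 c s, I3 c s, I7 c s]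

/-- The velocity `c' × c''` of the binormal motion. -/
noncomputable def velocity (c : ℝ → ImOctonion) (s : ℝ) : ImOctonion := cross (I4 c s) (deriv (I4 c) s)

namespace IsRegularOn

variable {c : ℝ → ImOctonion} {I : Set ℝ} {s : ℝ}

theorem smooth_I4 (h : IsRegularOn c I) : ContDiffOn ℝ ∞ (I4 c) I :=
  h.smooth.deriv_infty h.isOpen

theorem smooth_k1 (h : IsRegularOn c I) : ContDiffOn ℝ ∞ (k1 c) I :=
  (h.smooth_I4.deriv_infty h.isOpen).norm ℝ fun x hx => norm_pos_iff.1 (h.k1_pos x hx)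

theorem smooth_I1 (h : IsRegularOn c I) : ContDiffOn ℝ ∞ (I1 c) I :=
  (h.smooth_k1.inv fun x hx => (h.k1_pos x hx).ne').smul (h.smooth_I4.deriv_infty h.isOpen)

theorem smooth_I5 (h : IsRegularOn c I) : ContDiffOn ℝ ∞ (I5 c) I :=
  h.smooth_I1.octonionCross h.smooth_I4

theorem smooth_rho1 (h : IsRegularOn c I) : ContDiffOn ℝ ∞ (rho1 c) I :=
  (h.smooth_I1.deriv_infty h.isOpen).inner ℝ h.smooth_I5

theorem smooth_kappa2 (h : IsRegularOn c I) : ContDiffOn ℝ ∞ (kappa2 c) I := by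
  have h1 := h.smooth_I1.deriv_infty h.isOpen
  refine ContDiffOn.sqrt (((h1.norm_sq ℝ).sub ((h1.inner ℝ h.smooth_I4).pow 2)).sub
    (h.smooth_rho1.pow 2)) fun x hx => ?_
  -- A positive square root forces a positive radicand, where `√` is smooth.
  exact (Real.sqrt_pos.1 (h.kappa2_pos x hx)).ne'

theorem smooth_I2 (h : IsRegularOn c I) : ContDiffOn ℝ ∞ (I2 c) I := by
  have h1 := h.smooth_I1.deriv_infty h.isOpen
  exact (h.smooth_kappa2.inv fun x hx => (h.kappa2_pos x hx).ne').smul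
    ((h1.sub ((h1.inner ℝ h.smooth_I4).smul h.smooth_I4)).sub (h.smooth_rho1.smul h.smooth_I5))

theorem smooth_I3 (h : IsRegularOn c I) : ContDiffOn ℝ ∞ (I3 c) I :=
  h.smooth_I1.octonionCross h.smooth_I2

theorem smooth_I6 (h : IsRegularOn c I) : ContDiffOn ℝ ∞ (I6 c) I :=
  h.smooth_I2.octonionCross h.smooth_I4

theorem smooth_rho2 (h : IsRegularOn c I) : ContDiffOn ℝ ∞ (rho2 c) I :=
  (h.smooth_I2.deriv_infty h.isOpen).inner ℝ h.smooth_I6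

theorem inner_I4_self (h : IsRegularOn c I) (hs : s ∈ I) : ⟪I4 c s, I4 c s⟫ = 1 := by
  rw [real_inner_self_eq_norm_sq, I4, h.norm_deriv s hs, one_pow]

theorem deriv_I4 (h : IsRegularOn c I) (hs : s ∈ I) : deriv (I4 c) s = k1 c s • I1 c s := by
  rw [I1, smul_inv_smul₀ (h.k1_pos s hs).ne']

theorem inner_I1_self (h : IsRegularOn c I) (hs : s ∈ I) : ⟪I1 c s, I1 c s⟫ = 1 := by
  have hk := (h.k1_pos s hs).ne'
  rw [I1, real_inner_smul_left, real_inner_smul_right, real_inner_self_eq_norm_sq]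
  change (k1 c s)⁻¹ * ((k1 c s)⁻¹ * k1 c s ^ 2) = 1
  field_simp

theorem inner_I1_I4 (h : IsRegularOn c I) (hs : s ∈ I) : ⟪I1 c s, I4 c s⟫ = 0 := by
  have h1 := inner_deriv_eq_neg h.isOpen h.smooth_I4 h.smooth_I4
    (fun x hx => h.inner_I4_self hx) hs
  rw [I1, real_inner_smul_left, show ⟪deriv (I4 c) s, I4 c s⟫ = 0 by linarith, mul_zero]

theorem inner_deriv_I1_I4 (h : IsRegularOn c I) (hs : s ∈ I) :
    ⟪deriv (I1 c) s, I4 c s⟫ = -k1 c s := by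
  rw [inner_deriv_eq_neg h.isOpen h.smooth_I1 h.smooth_I4 (fun x hx => h.inner_I1_I4 hx) hs,
    h.deriv_I4 hs, real_inner_smul_left, h.inner_I1_self hs, mul_one]

theorem deriv_I1 (h : IsRegularOn c I) (hs : s ∈ I) :
    deriv (I1 c) s = -k1 c s • I4 c s + rho1 c s • I5 c s + kappa2 c s • I2 c s := by
  rw [I2, smul_inv_smul₀ (h.kappa2_pos s hs).ne', h.inner_deriv_I1_I4 hs, rho1]
  abel

/-- `I₂` is one Gram–Schmidt step: `I₁'`, already orthogonal to `I₁`, loses its components along the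
orthonormal pair `I₄, I₅`, and `κ₂` is the length of the remainder by Pythagoras. -/
theorem isBasicTriple (h : IsRegularOn c I) (hs : s ∈ I) :
    ImOctonion.IsBasicTriple (I1 c s) (I2 c s) (I4 c s) := by
  have aa := h.inner_I1_self hs
  have dd := h.inner_I4_self hs
  have ad := h.inner_I1_I4 hs
  have h11 : ⟪deriv (I1 c) s, I1 c s⟫ = 0 := by
    have := inner_deriv_eq_neg h.isOpen h.smooth_I1 h.smooth_I1
      (fun x hx => h.inner_I1_self hx) hs
    linarith
  have h55 : ⟪I5 c s, I5 c s⟫ = 1 := by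
    rw [I5, ImOctonion.inner_cross_cross, aa, dd, ad]; norm_num
  have h51 : ⟪I5 c s, I1 c s⟫ = 0 := ImOctonion.inner_cross_left _ _
  have h54 : ⟪I5 c s, I4 c s⟫ = 0 := ImOctonion.inner_cross_right _ _
  have h45 : ⟪I4 c s, I5 c s⟫ = 0 := (real_inner_comm _ _).trans h54
  have hk := (h.kappa2_pos s hs).ne'
  have h4 := real_inner_comm (I4 c s) (deriv (I1 c) s)
  have h5 := real_inner_comm (I5 c s) (deriv (I1 c) s)
  have hkk : kappa2 c s ^ 2 = ⟪deriv (I1 c) s, deriv (I1 c) s⟫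
      - ⟪deriv (I1 c) s, I4 c s⟫ ^ 2 - ⟪deriv (I1 c) s, I5 c s⟫ ^ 2 := by
    rw [real_inner_self_eq_norm_sq]
    exact Real.sq_sqrt (Real.sqrt_pos.1 (h.kappa2_pos s hs)).le
  refine ⟨aa, ?_, dd, ?_, ad, ?_, ?_⟩
  · rw [I2, real_inner_smul_left, real_inner_smul_right]
    simp only [inner_sub_left, inner_sub_right, real_inner_smul_left, real_inner_smul_right,
      dd, h55, h54, h45, h4, h5]
    field_simp
    rw [hkk, h4, h5]
    ring
  · rw [real_inner_comm, I2, real_inner_smul_left]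
    simp only [inner_sub_left, real_inner_smul_left, h11, h51, real_inner_comm (I1 c s) (I4 c s),
      ad]
    simp
  · rw [I2, real_inner_smul_left]
    simp only [inner_sub_left, real_inner_smul_left, dd, h54]
    simp
  · change ⟪I5 c s, I2 c s⟫ = 0
    rw [I2, real_inner_smul_right]
    simp only [inner_sub_right, real_inner_smul_right, h55, h54, h5]
    simp

theorem inner_frame (h : IsRegularOn c I) (hs : s ∈ I) (i j : Fin 7) :
    ⟪frame c s i, frame c s j⟫ = if i = j then 1 else 0 :=
  orthonormal_iff_ite.1 (h.isBasicTriple hs).orthonormal i j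

theorem deriv_I5 (h : IsRegularOn c I) (hs : s ∈ I) :
    deriv (I5 c) s = -rho1 c s • I1 c s + kappa2 c s • I6 c s := by
  have h1 := ((h.smooth_I1.hasDerivAt_of_isOpen h.isOpen hs).octonionCross
    (h.smooth_I4.hasDerivAt_of_isOpen h.isOpen hs)).deriv
  refine h1.trans ?_
  rw [h.deriv_I4 hs, h.deriv_I1 hs]
  simp only [ImOctonion.cross_add_left, ImOctonion.cross_smul_left, ImOctonion.cross_smul_right,
    ImOctonion.cross_self, I5, I6, (h.isBasicTriple hs).cross_ad_d]
  module

theorem deriv_I6 (h : IsRegularOn c I) (hs : s ∈ I) :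
    deriv (I6 c) s = cross (deriv (I2 c) s) (I4 c s) - k1 c s • I3 c s := by
  have h1 := ((h.smooth_I2.hasDerivAt_of_isOpen h.isOpen hs).octonionCross
    (h.smooth_I4.hasDerivAt_of_isOpen h.isOpen hs)).deriv
  refine h1.trans ?_
  rw [h.deriv_I4 hs, ImOctonion.cross_smul_right, ImOctonion.cross_swap (I1 c s) (I2 c s), I3]
  module

theorem inner_deriv_I2_I1 (h : IsRegularOn c I) (hs : s ∈ I) :
    ⟪deriv (I2 c) s, I1 c s⟫ = -kappa2 c s := by
  rw [inner_deriv_eq_neg h.isOpen h.smooth_I2 h.smooth_I1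
    (fun x hx => h.inner_frame hx 3 2) hs, h.deriv_I1 hs, neg_inj]
  have e0 : ⟪I4 c s, I2 c s⟫ = 0 := h.inner_frame hs 0 3
  have e1 : ⟪I5 c s, I2 c s⟫ = 0 := h.inner_frame hs 1 3
  have e3 : ⟪I2 c s, I2 c s⟫ = 1 := h.inner_frame hs 3 3
  simp only [inner_add_left, real_inner_smul_left, e0, e1, e3]
  ring

/-- Since `I₆ = I₂ × I₄`, the alternating form moves the factor `I₄` onto `v`. Components of `I₆'`
thus become components of `I₂'`, which are the defining invariants. -/
theorem inner_deriv_I6 (h : IsRegularOn c I) (hs : s ∈ I) (v : ImOctonion) :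
    ⟪deriv (I6 c) s, v⟫ = -⟪deriv (I2 c) s, cross v (I4 c s)⟫ - k1 c s * ⟪I3 c s, v⟫ := by
  rw [h.deriv_I6 hs, inner_sub_left, real_inner_smul_left, ImOctonion.inner_cross_cycle,
    ImOctonion.cross_swap v, inner_neg_right]

theorem inner_deriv_I6_I2 (h : IsRegularOn c I) (hs : s ∈ I) :
    ⟪deriv (I6 c) s, I2 c s⟫ = -rho2 c s := by
  have e : ⟪I3 c s, I2 c s⟫ = 0 := h.inner_frame hs 5 3
  rw [h.inner_deriv_I6 hs, e, ← I6, rho2]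
  ring

theorem inner_deriv_I6_I3 (h : IsRegularOn c I) (hs : s ∈ I) :
    ⟪deriv (I6 c) s, I3 c s⟫ = -beta1 c s - k1 c s := by
  have e : ⟪I3 c s, I3 c s⟫ = 1 := h.inner_frame hs 5 5
  rw [h.inner_deriv_I6 hs, e, ← I7, beta1]
  ring

theorem inner_deriv_I6_I5 (h : IsRegularOn c I) (hs : s ∈ I) :
    ⟪deriv (I6 c) s, I5 c s⟫ = -kappa2 c s := by
  have e : ⟪I3 c s, I5 c s⟫ = 0 := h.inner_frame hs 5 1
  rw [h.inner_deriv_I6 hs, e, I5, (h.isBasicTriple hs).cross_ad_d, inner_neg_right,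
    h.inner_deriv_I2_I1 hs]
  ring

theorem inner_deriv_I6_I6 (h : IsRegularOn c I) (hs : s ∈ I) :
    ⟪deriv (I6 c) s, I6 c s⟫ = 0 := by
  have := inner_deriv_eq_neg h.isOpen h.smooth_I6 h.smooth_I6
    (fun x hx => h.inner_frame hx 4 4) hs
  linarith

theorem inner_deriv_I6_I7 (h : IsRegularOn c I) (hs : s ∈ I) :
    ⟪deriv (I6 c) s, I7 c s⟫ = alpha c s := by
  have e : ⟪I3 c s, I7 c s⟫ = 0 := h.inner_frame hs 5 6
  rw [h.inner_deriv_I6 hs, e, I7, I3, (h.isBasicTriple hs).cross_abd_d, inner_neg_right,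
    alpha, I3]
  ring

/-- Differentiating `⟨I₃, I₆⟩ = 0` gives `β₂ = -⟨I₆', I₃⟩`; the extra `k₁` comes from `I₂ × I₄' =
-k₁ I₃`. -/
theorem beta2_eq (h : IsRegularOn c I) (hs : s ∈ I) : beta2 c s = beta1 c s + k1 c s := by
  rw [beta2, inner_deriv_eq_neg h.isOpen h.smooth_I3 h.smooth_I6
    (fun x hx => h.inner_frame hx 5 4) hs, h.inner_deriv_I6_I3 hs]
  ring

theorem velocity_eq (h : IsRegularOn c I) (hs : s ∈ I) :
    velocity c s = -(k1 c s • I5 c s) := by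
  rw [velocity, h.deriv_I4 hs, ImOctonion.cross_smul_right, ImOctonion.cross_swap (I1 c s), I5,
    smul_neg]

theorem hasDerivAt_velocity (h : IsRegularOn c I) (hs : s ∈ I) :
    HasDerivAt (velocity c) ((k1 c s * rho1 c s) • I1 c s - deriv (k1 c) s • I5 c s
      - (k1 c s * kappa2 c s) • I6 c s) s := by
  have h1 := ((h.smooth_k1.hasDerivAt_of_isOpen h.isOpen hs).smul
    (h.smooth_I5.hasDerivAt_of_isOpen h.isOpen hs)).neg
  rw [h.deriv_I5 hs] at h1
  refine (h1.congr_of_eventuallyEq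
    (Filter.eventually_of_mem (h.isOpen.mem_nhds hs) fun x hx => h.velocity_eq hx)).congr_deriv ?_
  module

/-- `I₆'` stays unexpanded: only its inner products with frame vectors are used later. -/
theorem deriv_deriv_velocity (h : IsRegularOn c I) (hs : s ∈ I) :
    deriv (deriv (velocity c)) s =
      (deriv (k1 c) s * rho1 c s + k1 c s * deriv (rho1 c) s) • I1 c s
      + (k1 c s * rho1 c s) • (-k1 c s • I4 c s + rho1 c s • I5 c s + kappa2 c s • I2 c s)
      - deriv (deriv (k1 c)) s • I5 c s
      - deriv (k1 c) s • (-rho1 c s • I1 c s + kappa2 c s • I6 c s)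
      - (deriv (k1 c) s * kappa2 c s + k1 c s * deriv (kappa2 c) s) • I6 c s
      - (k1 c s * kappa2 c s) • deriv (I6 c) s := by
  have hk := h.smooth_k1.hasDerivAt_of_isOpen h.isOpen hs
  have hk' := (h.smooth_k1.deriv_infty h.isOpen).hasDerivAt_of_isOpen h.isOpen hs
  have hr := h.smooth_rho1.hasDerivAt_of_isOpen h.isOpen hs
  have hkap := h.smooth_kappa2.hasDerivAt_of_isOpen h.isOpen hs
  have h1 := h.smooth_I1.hasDerivAt_of_isOpen h.isOpen hs
  have h5 := h.smooth_I5.hasDerivAt_of_isOpen h.isOpen hs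
  have h6 := h.smooth_I6.hasDerivAt_of_isOpen h.isOpen hs
  have key := (((hk.mul hr).smul h1).sub (hk'.smul h5)).sub ((hk.mul hkap).smul h6)
  rw [h.deriv_I5 hs, h.deriv_I1 hs] at key
  refine (key.congr_of_eventuallyEq (Filter.eventually_of_mem (h.isOpen.mem_nhds hs)
    fun x hx => (h.hasDerivAt_velocity hx).deriv)).deriv.trans ?_
  simp only [Pi.mul_apply]
  module

end IsRegularOn

/-- For the binormal motion with curve `c` at a given time, the time derivative of `c' × c''`. -/
noncomputable def acceleration (c : ℝ → ImOctonion) (s : ℝ) : ImOctonion :=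
  cross (deriv (velocity c) s) (deriv (I4 c) s) + cross (I4 c s) (deriv (deriv (velocity c)) s)

/-! ### Normal components of the acceleration. -/

namespace IsRegularOn

variable {c : ℝ → ImOctonion} {I : Set ℝ} {s : ℝ}

/-- The first two terms are `v_s × γ_ss`, by `I₅ × I₁ = I₄` and `I₆ × I₁ = I₇`. In the last one `I₄
×` has been moved to the test vector, and `· × I₄` permutes the frame vectors orthogonal to `I₄` up
to sign. -/
theorem inner_acceleration (h : IsRegularOn c I) (hs : s ∈ I) (v : ImOctonion) :
    ⟪acceleration c s, v⟫ = -(k1 c s * deriv (k1 c) s) * ⟪I4 c s, v⟫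
      - k1 c s ^ 2 * kappa2 c s * ⟪I7 c s, v⟫
      + ⟪deriv (deriv (velocity c)) s, cross v (I4 c s)⟫ := by
  have e5 : cross (I5 c s) (I1 c s) = I4 c s := by
    rw [ImOctonion.cross_swap (I1 c s), I5, (h.isBasicTriple hs).cross_a_ad, neg_neg]
  have e6 : cross (I6 c s) (I1 c s) = I7 c s := by
    rw [ImOctonion.cross_swap (I1 c s), I6, (h.isBasicTriple hs).cross_a_bd, neg_neg, I7, I3]
  have e : ∀ w, ⟪cross (I4 c s) w, v⟫ = ⟪w, cross v (I4 c s)⟫ := fun w => by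
    rw [ImOctonion.inner_cross_cycle, real_inner_comm, ImOctonion.inner_cross_cycle]
  rw [acceleration, (h.hasDerivAt_velocity hs).deriv, h.deriv_I4 hs, inner_add_left, e]
  simp only [sub_eq_add_neg, ← neg_smul, ImOctonion.cross_add_left, ImOctonion.cross_smul_left,
    ImOctonion.cross_smul_right, ImOctonion.cross_self, e5, e6, inner_add_left,
    real_inner_smul_left, inner_zero_left, smul_zero]
  ring

theorem inner_acceleration_I1 (h : IsRegularOn c I) (hs : s ∈ I) :
    ⟪acceleration c s, I1 c s⟫ = k1 c s * (rho1 c s ^ 2 + kappa2 c s ^ 2)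
      - deriv (deriv (k1 c)) s := by
  have e02 : ⟪I4 c s, I1 c s⟫ = 0 := h.inner_frame hs 0 2
  have e62 : ⟪I7 c s, I1 c s⟫ = 0 := h.inner_frame hs 6 2
  have e01 : ⟪I4 c s, I5 c s⟫ = 0 := h.inner_frame hs 0 1
  have e11 : ⟪I5 c s, I5 c s⟫ = 1 := h.inner_frame hs 1 1
  have e21 : ⟪I1 c s, I5 c s⟫ = 0 := h.inner_frame hs 2 1
  have e31 : ⟪I2 c s, I5 c s⟫ = 0 := h.inner_frame hs 3 1
  have e41 : ⟪I6 c s, I5 c s⟫ = 0 := h.inner_frame hs 4 1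
  rw [h.inner_acceleration hs, ← I5, h.deriv_deriv_velocity hs]
  simp only [inner_add_left, inner_sub_left, real_inner_smul_left, h.inner_deriv_I6_I5 hs,
    e02, e62, e01, e11, e21, e31, e41]
  ring

theorem inner_acceleration_I2 (h : IsRegularOn c I) (hs : s ∈ I) :
    ⟪acceleration c s, I2 c s⟫ =
      -(2 * deriv (k1 c) s * kappa2 c s + k1 c s * deriv (kappa2 c) s) := by
  have e03 : ⟪I4 c s, I2 c s⟫ = 0 := h.inner_frame hs 0 3
  have e63 : ⟪I7 c s, I2 c s⟫ = 0 := h.inner_frame hs 6 3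
  have e04 : ⟪I4 c s, I6 c s⟫ = 0 := h.inner_frame hs 0 4
  have e14 : ⟪I5 c s, I6 c s⟫ = 0 := h.inner_frame hs 1 4
  have e24 : ⟪I1 c s, I6 c s⟫ = 0 := h.inner_frame hs 2 4
  have e34 : ⟪I2 c s, I6 c s⟫ = 0 := h.inner_frame hs 3 4
  have e44 : ⟪I6 c s, I6 c s⟫ = 1 := h.inner_frame hs 4 4
  rw [h.inner_acceleration hs, ← I6, h.deriv_deriv_velocity hs]
  simp only [inner_add_left, inner_sub_left, real_inner_smul_left, h.inner_deriv_I6_I6 hs,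
    e03, e63, e04, e14, e24, e34, e44]
  ring

theorem inner_acceleration_I3 (h : IsRegularOn c I) (hs : s ∈ I) :
    ⟪acceleration c s, I3 c s⟫ = -(k1 c s * kappa2 c s * alpha c s) := by
  have e05 : ⟪I4 c s, I3 c s⟫ = 0 := h.inner_frame hs 0 5
  have e65 : ⟪I7 c s, I3 c s⟫ = 0 := h.inner_frame hs 6 5
  have e06 : ⟪I4 c s, I7 c s⟫ = 0 := h.inner_frame hs 0 6
  have e16 : ⟪I5 c s, I7 c s⟫ = 0 := h.inner_frame hs 1 6
  have e26 : ⟪I1 c s, I7 c s⟫ = 0 := h.inner_frame hs 2 6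
  have e36 : ⟪I2 c s, I7 c s⟫ = 0 := h.inner_frame hs 3 6
  have e46 : ⟪I6 c s, I7 c s⟫ = 0 := h.inner_frame hs 4 6
  rw [h.inner_acceleration hs, ← I7, h.deriv_deriv_velocity hs]
  simp only [inner_add_left, inner_sub_left, real_inner_smul_left, h.inner_deriv_I6_I7 hs,
    e05, e65, e06, e16, e26, e36, e46]
  ring

theorem inner_acceleration_I6 (h : IsRegularOn c I) (hs : s ∈ I) :
    ⟪acceleration c s, I6 c s⟫ = -(k1 c s * kappa2 c s * (rho1 c s + rho2 c s)) := by
  have e04 : ⟪I4 c s, I6 c s⟫ = 0 := h.inner_frame hs 0 4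
  have e64 : ⟪I7 c s, I6 c s⟫ = 0 := h.inner_frame hs 6 4
  have e03 : ⟪I4 c s, I2 c s⟫ = 0 := h.inner_frame hs 0 3
  have e13 : ⟪I5 c s, I2 c s⟫ = 0 := h.inner_frame hs 1 3
  have e23 : ⟪I1 c s, I2 c s⟫ = 0 := h.inner_frame hs 2 3
  have e33 : ⟪I2 c s, I2 c s⟫ = 1 := h.inner_frame hs 3 3
  have e43 : ⟪I6 c s, I2 c s⟫ = 0 := h.inner_frame hs 4 3
  have e : cross (I6 c s) (I4 c s) = -I2 c s := (h.isBasicTriple hs).cross_bd_d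
  rw [h.inner_acceleration hs, e, h.deriv_deriv_velocity hs]
  simp only [inner_add_left, inner_sub_left, inner_neg_right, real_inner_smul_left,
    h.inner_deriv_I6_I2 hs, e04, e64, e03, e13, e23, e33, e43]
  ring

/-- One `k₁` of the `2 k₁` comes from `v_s × γ_ss`, the other from the `I₃`-component of `I₆'`. -/
theorem inner_acceleration_I7 (h : IsRegularOn c I) (hs : s ∈ I) :
    ⟪acceleration c s, I7 c s⟫ =
      -(k1 c s * kappa2 c s * (beta1 c s + 2 * k1 c s)) := by
  have e06 : ⟪I4 c s, I7 c s⟫ = 0 := h.inner_frame hs 0 6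
  have e66 : ⟪I7 c s, I7 c s⟫ = 1 := h.inner_frame hs 6 6
  have e05 : ⟪I4 c s, I3 c s⟫ = 0 := h.inner_frame hs 0 5
  have e15 : ⟪I5 c s, I3 c s⟫ = 0 := h.inner_frame hs 1 5
  have e25 : ⟪I1 c s, I3 c s⟫ = 0 := h.inner_frame hs 2 5
  have e35 : ⟪I2 c s, I3 c s⟫ = 0 := h.inner_frame hs 3 5
  have e45 : ⟪I6 c s, I3 c s⟫ = 0 := h.inner_frame hs 4 5
  have e : cross (I7 c s) (I4 c s) = -I3 c s := (h.isBasicTriple hs).cross_abd_d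
  rw [h.inner_acceleration hs, e, h.deriv_deriv_velocity hs]
  simp only [inner_add_left, inner_sub_left, inner_neg_right, real_inner_smul_left,
    h.inner_deriv_I6_I3 hs, e06, e66, e05, e15, e25, e35, e45]
  ring

end IsRegularOn

end G2Curve

/-! ### The complex invariants in polar form -/

/-- Order-connectedness keeps the segment from `s₀` to `s` inside `I`, where `f` is continuous. -/
theorem hasDerivAt_intervalIntegral_of_continuousOn {f : ℝ → ℝ} {I : Set ℝ} (hI : IsOpen I)
    (hI' : I.OrdConnected) (hf : ContinuousOn f I) {s₀ s : ℝ} (hs₀ : s₀ ∈ I) (hs : s ∈ I) :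
    HasDerivAt (fun x => ∫ y in s₀..x, f y) (f s) s :=
  intervalIntegral.integral_hasDerivAt_right
    (hf.mono (hI'.uIcc_subset hs₀ hs)).intervalIntegrable
    (hf.stronglyMeasurableAtFilter hI s hs) (hf.continuousAt (hI.mem_nhds hs))

namespace G2Curve

/-- The unit complex number `exp (√-1 ∫ ρ)`. -/
noncomputable def phase (ρ : ℝ → ℝ) (s₀ s : ℝ) : ℂ :=
  Complex.exp (Complex.I * ((∫ x in s₀..s, ρ x : ℝ) : ℂ))

theorem conj_phase (ρ : ℝ → ℝ) (s₀ s : ℝ) :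
    conj (phase ρ s₀ s) = Complex.exp (-Complex.I * ((∫ x in s₀..s, ρ x : ℝ) : ℂ)) := by
  rw [phase, ← Complex.exp_conj, map_mul, Complex.conj_I, Complex.conj_ofReal]

theorem phase_mul_conj (ρ : ℝ → ℝ) (s₀ s : ℝ) : phase ρ s₀ s * conj (phase ρ s₀ s) = 1 := by
  rw [conj_phase, phase, ← Complex.exp_add, neg_mul, add_neg_cancel, Complex.exp_zero]

theorem norm_phase (ρ : ℝ → ℝ) (s₀ s : ℝ) : ‖phase ρ s₀ s‖ = 1 := by
  rw [phase, mul_comm, Complex.norm_exp_ofReal_mul_I]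

theorem hasDerivAt_phase {ρ : ℝ → ℝ} {I : Set ℝ} (hI : IsOpen I) (hI' : I.OrdConnected)
    (hρ : ContinuousOn ρ I) {s₀ s : ℝ} (hs₀ : s₀ ∈ I) (hs : s ∈ I) :
    HasDerivAt (phase ρ s₀) (Complex.I * ρ s * phase ρ s₀ s) s := by
  have h := (((hasDerivAt_intervalIntegral_of_continuousOn hI hI' hρ hs₀ hs).ofReal_comp).const_mul
    Complex.I).cexp
  exact h.congr_deriv (mul_comm _ _)

/-- With `w = 1/√2` made a variable, the relation `w² = 1/2` and `√2 = 2w` turn the identities below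
into polynomial algebra. -/
theorem inv_sqrt_two_sq : (((√2 : ℝ) : ℂ)⁻¹) ^ 2 = 1 / 2 := by
  rw [inv_pow, ← Complex.ofReal_pow, Real.sq_sqrt (by norm_num)]
  norm_num

theorem sqrt_two_eq : ((√2 : ℝ) : ℂ) = 2 * ((√2 : ℝ) : ℂ)⁻¹ := by
  have h : ((√2 : ℝ) : ℂ) ≠ 0 := Complex.ofReal_ne_zero.2 (by positivity)
  have := inv_sqrt_two_sq
  field_simp at this ⊢
  exact this.symm

theorem phi1_eq (c : ℝ → ImOctonion) (s₀ s : ℝ) :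
    phi1 c s₀ s = k1 c s * ((√2 : ℝ) : ℂ)⁻¹ * phase (rho1 c) s₀ s := by
  rw [phi1, r, ← conj_phase, map_mul, Complex.conj_conj, one_div, map_inv₀, Complex.conj_ofReal]
  ring

theorem phi2_eq (c : ℝ → ImOctonion) (s₀ s : ℝ) :
    phi2 c s₀ s = kappa2 c s * (conj (phase (rho1 c) s₀ s) * phase (rho2 c) s₀ s) := by
  rw [phi2, r, q, ← conj_phase, ← conj_phase, map_mul, Complex.conj_conj, one_div, map_inv₀,
    Complex.conj_ofReal]
  linear_combination (2 * kappa2 c s * conj (phase (rho1 c) s₀ s) * phase (rho2 c) s₀ s) *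
    inv_sqrt_two_sq

theorem phi3_eq (c : ℝ → ImOctonion) (s₀ s : ℝ) :
    phi3 c s₀ s = -(1 / 2) * (conj (phase (rho2 c) s₀ s) ^ 2 * conj (phase (rho1 c) s₀ s)) *
      (2 * alpha c s + Complex.I * (beta1 c s + beta2 c s)) := by
  have h := inv_sqrt_two_sq
  have e := sqrt_two_eq
  rw [phi3, r, q, ← conj_phase, ← conj_phase, one_div]
  generalize ((√2 : ℝ) : ℂ)⁻¹ = w at *
  rw [e]
  -- The constant is `√2 (1/√2)³ = 2w⁴`, and `2w⁴ - 1/2 = (2w² + 1)(w² - 1/2)`.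
  linear_combination (-(2 * w ^ 2 + 1) * (conj (phase (rho2 c) s₀ s) ^ 2 *
    conj (phase (rho1 c) s₀ s)) * (2 * alpha c s + Complex.I * (beta1 c s + beta2 c s))) * h

theorem k1_nonneg (c : ℝ → ImOctonion) (s : ℝ) : 0 ≤ k1 c s := norm_nonneg _

theorem kappa2_nonneg (c : ℝ → ImOctonion) (s : ℝ) : 0 ≤ kappa2 c s := Real.sqrt_nonneg _

theorem norm_phi1 (c : ℝ → ImOctonion) (s₀ s : ℝ) : ‖phi1 c s₀ s‖ = k1 c s * (√2)⁻¹ := by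
  rw [phi1_eq, norm_mul, norm_mul, norm_phase, norm_inv, Complex.norm_real, Complex.norm_real,
    Real.norm_of_nonneg (k1_nonneg c s), Real.norm_of_nonneg (Real.sqrt_nonneg _), mul_one]

theorem norm_phi2 (c : ℝ → ImOctonion) (s₀ s : ℝ) : ‖phi2 c s₀ s‖ = kappa2 c s := by
  rw [phi2_eq, norm_mul, norm_mul, Complex.norm_conj, norm_phase, norm_phase, Complex.norm_real,
    Real.norm_of_nonneg (kappa2_nonneg c s), mul_one, mul_one]

/-! ### Derivatives of the complex invariants and the expressions built from them. -/

namespace IsRegularOn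

variable {c : ℝ → ImOctonion} {I : Set ℝ} {s₀ s : ℝ}

theorem hasDerivAt_phi1 (h : IsRegularOn c I) (hI' : I.OrdConnected) (hs₀ : s₀ ∈ I) (hs : s ∈ I) :
    HasDerivAt (phi1 c s₀) ((deriv (k1 c) s + Complex.I * k1 c s * rho1 c s) *
      ((√2 : ℝ) : ℂ)⁻¹ * phase (rho1 c) s₀ s) s := by
  have h1 := ((h.smooth_k1.hasDerivAt_of_isOpen h.isOpen hs).ofReal_comp.mul_const
    (((√2 : ℝ) : ℂ)⁻¹)).mul
    (hasDerivAt_phase h.isOpen hI' h.smooth_rho1.continuousOn hs₀ hs)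
  refine (h1.congr_of_eventuallyEq (Filter.Eventually.of_forall (phi1_eq c s₀))).congr_deriv ?_
  ring

theorem deriv_deriv_phi1 (h : IsRegularOn c I) (hI' : I.OrdConnected) (hs₀ : s₀ ∈ I)
    (hs : s ∈ I) : deriv (deriv (phi1 c s₀)) s =
      (deriv (deriv (k1 c)) s - k1 c s * rho1 c s ^ 2
        + Complex.I * (2 * deriv (k1 c) s * rho1 c s + k1 c s * deriv (rho1 c) s)) *
      ((√2 : ℝ) : ℂ)⁻¹ * phase (rho1 c) s₀ s := by
  have hk := (h.smooth_k1.hasDerivAt_of_isOpen h.isOpen hs).ofReal_comp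
  have hk' := ((h.smooth_k1.deriv_infty h.isOpen).hasDerivAt_of_isOpen h.isOpen hs).ofReal_comp
  have hr := (h.smooth_rho1.hasDerivAt_of_isOpen h.isOpen hs).ofReal_comp
  have h1 := ((hk'.add ((hk.const_mul Complex.I).mul hr)).mul_const
    (((√2 : ℝ) : ℂ)⁻¹)).mul (hasDerivAt_phase h.isOpen hI' h.smooth_rho1.continuousOn hs₀ hs)
  refine (h1.congr_of_eventuallyEq (Filter.eventually_of_mem (h.isOpen.mem_nhds hs)
    fun x hx => (h.hasDerivAt_phi1 hI' hs₀ hx).deriv)).deriv.trans ?_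
  simp only [Pi.add_apply, Pi.mul_apply]
  linear_combination (k1 c s * rho1 c s ^ 2 * ((√2 : ℝ) : ℂ)⁻¹ * phase (rho1 c) s₀ s)
    * Complex.I_sq

theorem hasDerivAt_phi2 (h : IsRegularOn c I) (hI' : I.OrdConnected) (hs₀ : s₀ ∈ I) (hs : s ∈ I) :
    HasDerivAt (phi2 c s₀) ((deriv (kappa2 c) s
      + Complex.I * kappa2 c s * (rho2 c s - rho1 c s)) *
      (conj (phase (rho1 c) s₀ s) * phase (rho2 c) s₀ s)) s := by
  have hp1 := hasDerivAt_phase h.isOpen hI' h.smooth_rho1.continuousOn hs₀ hs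
  have hp2 := hasDerivAt_phase h.isOpen hI' h.smooth_rho2.continuousOn hs₀ hs
  have h1 := (h.smooth_kappa2.hasDerivAt_of_isOpen h.isOpen hs).ofReal_comp.mul
    (hp1.star.mul hp2)
  refine (h1.congr_of_eventuallyEq (Filter.Eventually.of_forall (phi2_eq c s₀))).congr_deriv ?_
  simp only [Pi.mul_apply, Complex.star_def, map_mul, Complex.conj_I, Complex.conj_ofReal]
  ring

theorem phi1_ne_zero (h : IsRegularOn c I) (hs : s ∈ I) : phi1 c s₀ s ≠ 0 := by
  have := h.k1_pos s hs
  rw [← norm_pos_iff, norm_phi1]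
  positivity

/-- The moduli cancel in the quotient, which equals `exp(-2√-1 ∫ρ₁)`. -/
theorem logDeriv_conj_phi1_div (h : IsRegularOn c I) (hI' : I.OrdConnected) (hs₀ : s₀ ∈ I)
    (hs : s ∈ I) :
    logDeriv (fun x => conj (phi1 c s₀ x) / phi1 c s₀ x) s = -2 * Complex.I * rho1 c s := by
  have hd := h.hasDerivAt_phi1 hI' hs₀ hs
  have hne : phi1 c s₀ s ≠ 0 := h.phi1_ne_zero hs
  have hc : HasDerivAt (fun x => conj (phi1 c s₀ x)) _ s := hd.star
  have hne' : conj (phi1 c s₀ s) ≠ 0 := (map_ne_zero _).2 hne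
  have hk : (k1 c s : ℂ) ≠ 0 := Complex.ofReal_ne_zero.2 (h.k1_pos s hs).ne'
  have hw : ((√2 : ℝ) : ℂ)⁻¹ ≠ 0 := inv_ne_zero (Complex.ofReal_ne_zero.2 (by positivity))
  have hu := phase_mul_conj (rho1 c) s₀ s
  have hu1 : phase (rho1 c) s₀ s ≠ 0 := left_ne_zero_of_mul_eq_one hu
  have hu2 : conj (phase (rho1 c) s₀ s) ≠ 0 := right_ne_zero_of_mul_eq_one hu
  rw [logDeriv_apply, (hc.fun_div hd hne).deriv]
  simp only [phi1_eq, Complex.star_def, map_mul, map_add, map_inv₀, Complex.conj_I,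
    Complex.conj_ofReal]
  generalize ((√2 : ℝ) : ℂ)⁻¹ = w at *
  field_simp
  ring

theorem second_fundamental_322 (h : IsRegularOn c I) (hI' : I.OrdConnected) (hs₀ : s₀ ∈ I)
    (hs : s ∈ I) :
    -(phi1 c s₀ s * conj (deriv (deriv (phi1 c s₀)) s)
        + conj (phi1 c s₀ s) * deriv (deriv (phi1 c s₀)) s)
          / (2 * (√2 : ℝ) * (‖phi1 c s₀ s‖ : ℂ) ^ 3)
        + (‖phi2 c s₀ s‖ : ℂ) ^ 2 / ((√2 : ℝ) * ‖phi1 c s₀ s‖)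
      = (k1 c s * (rho1 c s ^ 2 + kappa2 c s ^ 2) - deriv (deriv (k1 c)) s) / k1 c s ^ 2 := by
  have hk : (k1 c s : ℂ) ≠ 0 := Complex.ofReal_ne_zero.2 (h.k1_pos s hs).ne'
  have hu := phase_mul_conj (rho1 c) s₀ s
  have hw := inv_sqrt_two_sq
  -- This is twice the real part of `conj φ₁ · φ₁''`: the phases cancel and the imaginary part of
  -- the bracket in `deriv_deriv_phi1` drops out.
  have hN : phi1 c s₀ s * conj (deriv (deriv (phi1 c s₀)) s)
        + conj (phi1 c s₀ s) * deriv (deriv (phi1 c s₀)) s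
      = k1 c s * (deriv (deriv (k1 c)) s - k1 c s * rho1 c s ^ 2) := by
    rw [h.deriv_deriv_phi1 hI' hs₀ hs, phi1_eq]
    simp only [map_mul, map_add, map_sub, map_pow, map_inv₀, Complex.conj_I, Complex.conj_ofReal,
      map_ofNat]
    generalize ((√2 : ℝ) : ℂ)⁻¹ = w at *
    generalize conj (phase (rho1 c) s₀ s) = v at *
    generalize phase (rho1 c) s₀ s = u at *
    linear_combination (2 * k1 c s * (((deriv (deriv (k1 c)) s : ℝ) : ℂ) - k1 c s * rho1 c s ^ 2)) *
      (u * v * hw + 1 / 2 * hu)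
  rw [hN, norm_phi1, norm_phi2, sqrt_two_eq]
  push_cast
  generalize ((√2 : ℝ) : ℂ)⁻¹ = w at *
  have e3 : 2 * (2 * w) * (k1 c s * w) ^ 3 = (k1 c s : ℂ) ^ 3 := by
    linear_combination (4 * (w ^ 2 + 1 / 2) * k1 c s ^ 3) * hw
  have e1 : 2 * w * (k1 c s * w) = (k1 c s : ℂ) := by linear_combination (2 * k1 c s) * hw
  rw [e3, e1]
  field_simp
  ring

/-- The phase of `φ₂` turns at rate `ρ₂ - ρ₁`. The logarithmic derivative adds `2ρ₁` to this rate
and so produces `ρ₁ + ρ₂`. -/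
theorem second_fundamental_522 (h : IsRegularOn c I) (hI' : I.OrdConnected) (hs₀ : s₀ ∈ I)
    (hs : s ∈ I) :
    -(Complex.I * (2 * logDeriv (fun x => conj (phi1 c s₀ x) / phi1 c s₀ x) s
              * (‖phi2 c s₀ s‖ : ℂ) ^ 2
            + phi2 c s₀ s * conj (deriv (phi2 c s₀) s)
            - conj (phi2 c s₀ s) * deriv (phi2 c s₀) s))
          / (2 * (√2 : ℝ) * ‖phi1 c s₀ s‖ * ‖phi2 c s₀ s‖)
      = -(k1 c s * kappa2 c s * (rho1 c s + rho2 c s)) / k1 c s ^ 2 := by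
  have hk : (k1 c s : ℂ) ≠ 0 := Complex.ofReal_ne_zero.2 (h.k1_pos s hs).ne'
  have hk2 : (kappa2 c s : ℂ) ≠ 0 := Complex.ofReal_ne_zero.2 (h.kappa2_pos s hs).ne'
  have hu := phase_mul_conj (rho1 c) s₀ s
  have hv := phase_mul_conj (rho2 c) s₀ s
  have hw := inv_sqrt_two_sq
  have hN : phi2 c s₀ s * conj (deriv (phi2 c s₀) s) - conj (phi2 c s₀ s) * deriv (phi2 c s₀) s
      = -2 * Complex.I * kappa2 c s ^ 2 * (rho2 c s - rho1 c s) := by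
    rw [(h.hasDerivAt_phi2 hI' hs₀ hs).deriv, phi2_eq]
    simp only [map_mul, map_add, map_sub, Complex.conj_I, Complex.conj_ofReal, Complex.conj_conj]
    linear_combination (-2 * Complex.I * kappa2 c s ^ 2 * (rho2 c s - rho1 c s)) *
      (phase (rho1 c) s₀ s * conj (phase (rho1 c) s₀ s) * hv + hu)
  rw [add_sub_assoc, hN, h.logDeriv_conj_phi1_div hI' hs₀ hs, norm_phi1, norm_phi2, sqrt_two_eq]
  push_cast
  generalize ((√2 : ℝ) : ℂ)⁻¹ = w at *
  have e1 : 2 * (2 * w) * (k1 c s * w) * kappa2 c s = (2 * k1 c s * kappa2 c s : ℂ) := by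
    linear_combination (4 * k1 c s * kappa2 c s) * hw
  rw [e1]
  field_simp
  linear_combination (rho1 c s + rho2 c s) * Complex.I_sq

/-- The exponents are chosen so that the phases cancel: `3∫ρ₁ + 2(∫ρ₂ - ∫ρ₁) - (2∫ρ₂ + ∫ρ₁) = 0`. -/
theorem phi_product (c : ℝ → ImOctonion) (s₀ s : ℝ) :
    phi1 c s₀ s ^ 3 * phi2 c s₀ s ^ 2 * phi3 c s₀ s =
      -(1 / 4) * ((√2 : ℝ) : ℂ)⁻¹ * k1 c s ^ 3 * kappa2 c s ^ 2 *
        (2 * alpha c s + Complex.I * (beta1 c s + beta2 c s)) := by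
  have hu := phase_mul_conj (rho1 c) s₀ s
  have hv := phase_mul_conj (rho2 c) s₀ s
  have hw := inv_sqrt_two_sq
  rw [phi1_eq, phi2_eq, phi3_eq]
  generalize ((√2 : ℝ) : ℂ)⁻¹ = w at *
  generalize conj (phase (rho1 c) s₀ s) = u' at *
  generalize phase (rho1 c) s₀ s = u at *
  generalize conj (phase (rho2 c) s₀ s) = v' at *
  generalize phase (rho2 c) s₀ s = v at *
  calc _ = -(1 / 2) * (w ^ 2) * w * k1 c s ^ 3 * kappa2 c s ^ 2 *
        (2 * alpha c s + Complex.I * (beta1 c s + beta2 c s)) * (u * u') ^ 3 * (v * v') ^ 2 := by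
        ring
    _ = _ := by rw [hu, hv, hw]; ring

theorem conj_phi_product (c : ℝ → ImOctonion) (s₀ s : ℝ) :
    conj (phi1 c s₀ s) ^ 3 * conj (phi2 c s₀ s) ^ 2 * conj (phi3 c s₀ s) =
      -(1 / 4) * ((√2 : ℝ) : ℂ)⁻¹ * k1 c s ^ 3 * kappa2 c s ^ 2 *
        (2 * alpha c s - Complex.I * (beta1 c s + beta2 c s)) := by
  have h := congrArg conj (phi_product c s₀ s)
  simp only [map_mul, map_pow] at h
  rw [h]
  simp [sub_eq_add_neg, map_ofNat]

theorem phi_denominator (c : ℝ → ImOctonion) (s₀ s : ℝ) :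
    2 * ((√2 : ℝ) : ℂ) * (‖phi1 c s₀ s‖ : ℂ) ^ 4 * ‖phi2 c s₀ s‖ =
      ((√2 : ℝ) : ℂ)⁻¹ * k1 c s ^ 4 * kappa2 c s := by
  have hw := inv_sqrt_two_sq
  have e := sqrt_two_eq
  rw [norm_phi1, norm_phi2]
  push_cast
  generalize ((√2 : ℝ) : ℂ)⁻¹ = w at *
  rw [e]
  linear_combination (4 * (w ^ 2 + 1 / 2) * w * k1 c s ^ 4 * kappa2 c s) * hw

theorem second_fundamental_622 (h : IsRegularOn c I) (hs : s ∈ I) :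
    (phi1 c s₀ s ^ 3 * phi2 c s₀ s ^ 2 * phi3 c s₀ s
        + conj (phi1 c s₀ s) ^ 3 * conj (phi2 c s₀ s) ^ 2 * conj (phi3 c s₀ s))
          / (2 * (√2 : ℝ) * (‖phi1 c s₀ s‖ : ℂ) ^ 4 * ‖phi2 c s₀ s‖)
      = -(k1 c s * kappa2 c s * alpha c s) / k1 c s ^ 2 := by
  have hk : (k1 c s : ℂ) ≠ 0 := Complex.ofReal_ne_zero.2 (h.k1_pos s hs).ne'
  have hk2 : (kappa2 c s : ℂ) ≠ 0 := Complex.ofReal_ne_zero.2 (h.kappa2_pos s hs).ne'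
  have hw : ((√2 : ℝ) : ℂ)⁻¹ ≠ 0 := inv_ne_zero (Complex.ofReal_ne_zero.2 (by positivity))
  rw [phi_product, conj_phi_product, phi_denominator]
  generalize ((√2 : ℝ) : ℂ)⁻¹ = w at *
  field_simp
  ring

/-- By `β₂ = β₁ + k₁` the quotient contributes `-κ₂ β₁/k₁ - κ₂/2`, and the correction `-3κ₂/2`
completes this to `-κ₂ (β₁ + 2k₁)/k₁`. -/
theorem second_fundamental_722 (h : IsRegularOn c I) (hs : s ∈ I) :
    Complex.I * (conj (phi1 c s₀ s) ^ 3 * conj (phi2 c s₀ s) ^ 2 * conj (phi3 c s₀ s)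
        - phi1 c s₀ s ^ 3 * phi2 c s₀ s ^ 2 * phi3 c s₀ s)
          / (2 * (√2 : ℝ) * (‖phi1 c s₀ s‖ : ℂ) ^ 4 * ‖phi2 c s₀ s‖) - 3 * ‖phi2 c s₀ s‖ / 2
      = -(k1 c s * kappa2 c s * (beta1 c s + 2 * k1 c s)) / k1 c s ^ 2 := by
  have hk : (k1 c s : ℂ) ≠ 0 := Complex.ofReal_ne_zero.2 (h.k1_pos s hs).ne'
  have hk2 : (kappa2 c s : ℂ) ≠ 0 := Complex.ofReal_ne_zero.2 (h.kappa2_pos s hs).ne'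
  have hw : ((√2 : ℝ) : ℂ)⁻¹ ≠ 0 := inv_ne_zero (Complex.ofReal_ne_zero.2 (by positivity))
  rw [phi_product, conj_phi_product, phi_denominator, norm_phi2, h.beta2_eq hs]
  generalize ((√2 : ℝ) : ℂ)⁻¹ = w at *
  push_cast
  field_simp
  linear_combination (8 * beta1 c s + 4 * k1 c s) * Complex.I_sq

theorem second_fundamental_422 (h : IsRegularOn c I) (hs : s ∈ I) :
    -(2 * deriv (fun x => Real.log ‖phi1 c s₀ x‖) s * ‖phi2 c s₀ s‖
        + deriv (fun x => ‖phi2 c s₀ x‖) s) / (√2 * ‖phi1 c s₀ s‖)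
      = -(2 * deriv (k1 c) s * kappa2 c s + k1 c s * deriv (kappa2 c) s) / k1 c s ^ 2 := by
  have hk := (h.k1_pos s hs).ne'
  have hw : (√2 : ℝ) ≠ 0 := by positivity
  simp only [norm_phi1, norm_phi2]
  have hd := ((h.smooth_k1.hasDerivAt_of_isOpen h.isOpen hs).mul_const (√2)⁻¹).log
    (mul_ne_zero hk (inv_ne_zero hw))
  rw [hd.deriv]
  change -(2 * _ * kappa2 c s + deriv (kappa2 c) s) / _ = _
  field_simp

end IsRegularOn

end G2Curve

/-! ### Partial derivatives on an open subset of the plane -/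

section PartialDerivatives

variable {F : Type*} [NormedAddCommGroup F] [NormedSpace ℝ F] {f : ℝ × ℝ → F}

theorem HasFDerivAt.hasDerivAt_snd {D : ℝ × ℝ →L[ℝ] F} {t s : ℝ}
    (h : HasFDerivAt f D (t, s)) : HasDerivAt (fun x => f (t, x)) (D (0, 1)) s :=
  h.comp_hasDerivAt s ((hasDerivAt_const s t).prodMk (hasDerivAt_id s))

theorem HasFDerivAt.hasDerivAt_fst {D : ℝ × ℝ →L[ℝ] F} {t s : ℝ}
    (h : HasFDerivAt f D (t, s)) : HasDerivAt (fun x => f (x, s)) (D (1, 0)) t :=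
  h.comp_hasDerivAt t ((hasDerivAt_id t).prodMk (hasDerivAt_const t s))

variable {U : Set (ℝ × ℝ)}

theorem ContDiffOn.hasFDerivAt_of_isOpen (hf : ContDiffOn ℝ ∞ f U) (hU : IsOpen U) {p : ℝ × ℝ}
    (hp : p ∈ U) : HasFDerivAt f (fderiv ℝ f p) p :=
  ((hf.contDiffAt (hU.mem_nhds hp)).differentiableAt (by simp)).hasFDerivAt

theorem ContDiffOn.fderiv_apply_infty (hf : ContDiffOn ℝ ∞ f U) (hU : IsOpen U) (v : ℝ × ℝ) :
    ContDiffOn ℝ ∞ (fun q => fderiv ℝ f q v) U :=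
  (hf.fderiv_of_isOpen hU (by simp)).clm_apply contDiffOn_const

theorem ContDiffOn.fderiv_fderiv_comm (hf : ContDiffOn ℝ ∞ f U) (hU : IsOpen U) {p : ℝ × ℝ}
    (hp : p ∈ U) (v w : ℝ × ℝ) :
    fderiv ℝ (fun q => fderiv ℝ f q v) p w = fderiv ℝ (fun q => fderiv ℝ f q w) p v := by
  have h1 : DifferentiableAt ℝ (fderiv ℝ f) p :=
    ((hf.fderiv_of_isOpen hU (m := ∞) (by simp)).contDiffAt (hU.mem_nhds hp)).differentiableAt
      (by simp)
  have h2 : ∀ v w : ℝ × ℝ, fderiv ℝ (fun q => fderiv ℝ f q v) p w = fderiv ℝ (fderiv ℝ f) p w v :=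
    fun v w => by simp [fderiv_clm_apply h1 (differentiableAt_const v)]
  rw [h2, h2]
  exact ((hf.contDiffAt (hU.mem_nhds hp)).isSymmSndFDerivAt
    (by simpa using (WithTop.coe_le_coe.2 (le_top : (2 : ℕ∞) ≤ ⊤) : (2 : WithTop ℕ∞) ≤ ∞))) w v

end PartialDerivatives

/-! ### The surface swept out by the binormal motion -/

namespace G2Surface

open G2Curve (I1 I2 I3 I4 I5 I6 I7 k1 kappa2 rho1 velocity acceleration frame)

/-- A smooth family of unit speed curves with a frame, moving by the binormal motion. -/
structure IsBinormalMotion (γ : ℝ → ℝ → ImOctonion) (J I : Set ℝ) : Prop where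
  isOpen : IsOpen J
  smooth : ContDiffOn ℝ ∞ (fun p : ℝ × ℝ => γ p.1 p.2) (J ×ˢ I)
  regular : ∀ t ∈ J, G2Curve.IsRegularOn (γ t) I
  flow : ∀ t ∈ J, ∀ s ∈ I, deriv (fun τ => γ τ s) t = velocity (γ t) s

/-- `γ_s`, as a function on the parameter plane. -/
noncomputable def gammaS (γ : ℝ → ℝ → ImOctonion) (p : ℝ × ℝ) : ImOctonion := dGamma γ p (0, 1)

/-- `γ_ss`, as a function on the parameter plane. -/
noncomputable def gammaSS (γ : ℝ → ℝ → ImOctonion) (p : ℝ × ℝ) : ImOctonion :=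
  fderiv ℝ (gammaS γ) p (0, 1)

namespace IsBinormalMotion

variable {γ : ℝ → ℝ → ImOctonion} {J I : Set ℝ} {t s : ℝ}

theorem isOpen_prod (h : IsBinormalMotion γ J I) (ht : t ∈ J) : IsOpen (J ×ˢ I) :=
  h.isOpen.prod (h.regular t ht).isOpen

theorem dGamma_snd (h : IsBinormalMotion γ J I) (ht : t ∈ J) (hs : s ∈ I) :
    dGamma γ (t, s) (0, 1) = I4 (γ t) s :=
  (h.smooth.hasFDerivAt_of_isOpen (h.isOpen_prod ht)
    (Set.mk_mem_prod ht hs)).hasDerivAt_snd.deriv.symm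

theorem dGamma_fst (h : IsBinormalMotion γ J I) (ht : t ∈ J) (hs : s ∈ I) :
    dGamma γ (t, s) (1, 0) = velocity (γ t) s := by
  rw [← h.flow t ht s hs]
  exact (h.smooth.hasFDerivAt_of_isOpen (h.isOpen_prod ht)
    (Set.mk_mem_prod ht hs)).hasDerivAt_fst.deriv.symm

theorem smooth_gammaS (h : IsBinormalMotion γ J I) (ht : t ∈ J) :
    ContDiffOn ℝ ∞ (gammaS γ) (J ×ˢ I) :=
  h.smooth.fderiv_apply_infty (h.isOpen_prod ht) (0, 1)

theorem smooth_gammaSS (h : IsBinormalMotion γ J I) (ht : t ∈ J) :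
    ContDiffOn ℝ ∞ (gammaSS γ) (J ×ˢ I) :=
  (h.smooth_gammaS ht).fderiv_apply_infty (h.isOpen_prod ht) (0, 1)

theorem gammaSS_eq (h : IsBinormalMotion γ J I) (ht : t ∈ J) (hs : s ∈ I) :
    gammaSS γ (t, s) = deriv (I4 (γ t)) s := by
  have h1 := ((h.smooth_gammaS ht).hasFDerivAt_of_isOpen (h.isOpen_prod ht)
    (Set.mk_mem_prod ht hs)).hasDerivAt_snd
  exact (h1.congr_of_eventuallyEq (Filter.eventually_of_mem
    ((h.regular t ht).isOpen.mem_nhds hs) fun x hx => (h.dGamma_snd ht hx).symm)).deriv.symm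

/-- Equality of mixed partials followed by the flow equation: `γ_st = γ_ts = v_s`. -/
theorem fderiv_gammaS_fst (h : IsBinormalMotion γ J I) (ht : t ∈ J) (hs : s ∈ I) :
    fderiv ℝ (gammaS γ) (t, s) (1, 0) = deriv (velocity (γ t)) s := by
  have hU := h.isOpen_prod ht
  refine (h.smooth.fderiv_fderiv_comm hU (Set.mk_mem_prod ht hs) (0, 1) (1, 0)).trans ?_
  have h1 := ((h.smooth.fderiv_apply_infty hU (1, 0)).hasFDerivAt_of_isOpen hU
    (Set.mk_mem_prod ht hs)).hasDerivAt_snd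
  exact (h1.congr_of_eventuallyEq (Filter.eventually_of_mem
    ((h.regular t ht).isOpen.mem_nhds hs) fun x hx => (h.dGamma_fst ht hx).symm)).deriv.symm

theorem fderiv_gammaSS_fst (h : IsBinormalMotion γ J I) (ht : t ∈ J) (hs : s ∈ I) :
    fderiv ℝ (gammaSS γ) (t, s) (1, 0) = deriv (deriv (velocity (γ t))) s := by
  have hU := h.isOpen_prod ht
  refine ((h.smooth_gammaS ht).fderiv_fderiv_comm hU (Set.mk_mem_prod ht hs) (0, 1)
    (1, 0)).trans ?_
  have h1 := (((h.smooth_gammaS ht).fderiv_apply_infty hU (1, 0)).hasFDerivAt_of_isOpen hU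
    (Set.mk_mem_prod ht hs)).hasDerivAt_snd
  exact (h1.congr_of_eventuallyEq (Filter.eventually_of_mem
    ((h.regular t ht).isOpen.mem_nhds hs)
    fun x hx => (h.fderiv_gammaS_fst ht hx).symm)).deriv.symm

theorem hasFDerivAt_E_one (h : IsBinormalMotion γ J I) (ht : t ∈ J) (hs : s ∈ I) :
    HasFDerivAt (E γ 1) (fderiv ℝ (gammaS γ) (t, s)) (t, s) := by
  have hU := h.isOpen_prod ht
  refine ((h.smooth_gammaS ht).hasFDerivAt_of_isOpen hU
    (Set.mk_mem_prod ht hs)).congr_of_eventuallyEq (Filter.eventually_of_mem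
    (hU.mem_nhds (Set.mk_mem_prod ht hs)) fun p hp => (h.dGamma_snd hp.1 hp.2).symm)

/-- `I₅` is built curve by curve; this form writes `E₂` through the jointly smooth `γ_s, γ_ss`, so
it can be differentiated in `t`. -/
theorem E_two_eq (h : IsBinormalMotion γ J I) (ht : t ∈ J) (hs : s ∈ I) :
    E γ 2 (t, s) = ‖gammaSS γ (t, s)‖⁻¹ • cross (gammaS γ (t, s)) (gammaSS γ (t, s)) := by
  rw [h.gammaSS_eq ht hs, gammaS, h.dGamma_snd ht hs]
  change -I5 (γ t) s = (k1 (γ t) s)⁻¹ • velocity (γ t) s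
  rw [(h.regular t ht).velocity_eq hs, smul_neg,
    inv_smul_smul₀ ((h.regular t ht).k1_pos s hs).ne']

theorem hasFDerivAt_E_two (h : IsBinormalMotion γ J I) (ht : t ∈ J) (hs : s ∈ I) :
    ∃ D : ℝ × ℝ →L[ℝ] ImOctonion, HasFDerivAt (E γ 2) D (t, s) ∧
      ∃ μ : ℝ, D (1, 0) = (k1 (γ t) s)⁻¹ • acceleration (γ t) s + μ • I5 (γ t) s := by
  have hU := h.isOpen_prod ht
  have hp := Set.mk_mem_prod ht hs
  have h1 := (h.smooth_gammaS ht).hasFDerivAt_of_isOpen hU hp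
  have h2 := (h.smooth_gammaSS ht).hasFDerivAt_of_isOpen hU hp
  have hk : ContDiffOn ℝ ∞ (fun p => ‖gammaSS γ p‖⁻¹) (J ×ˢ I) := by
    have hne : ∀ p ∈ J ×ˢ I, gammaSS γ p ≠ 0 := fun p hp => by
      rw [← norm_pos_iff, h.gammaSS_eq hp.1 hp.2]
      exact (h.regular p.1 hp.1).k1_pos p.2 hp.2
    exact ((h.smooth_gammaSS ht).norm ℝ hne).inv fun p hp => norm_ne_zero_iff.2 (hne p hp)
  obtain ⟨D, hD, hDv⟩ := h1.octonionCross h2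
  refine ⟨_, ((hk.hasFDerivAt_of_isOpen hU hp).smul hD).congr_of_eventuallyEq
    (Filter.eventually_of_mem (hU.mem_nhds hp) fun p hp => h.E_two_eq hp.1 hp.2),
    -- The derivative of the factor `1/k₁` multiplies `γ_s × γ_ss = -k₁ I₅`. The result is
    -- tangential, so its value does not affect `h^a_22`.
    fderiv ℝ (fun p => ‖gammaSS γ p‖⁻¹) (t, s) (1, 0) * -k1 (γ t) s, ?_⟩
  have hv := (h.regular t ht).velocity_eq hs
  simp only [add_apply, smul_apply,
    ContinuousLinearMap.smulRight_apply, hDv, h.fderiv_gammaS_fst ht hs,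
    h.fderiv_gammaSS_fst ht hs, h.gammaSS_eq ht hs]
  rw [gammaS, h.dGamma_snd ht hs, ← velocity, hv, acceleration, k1]
  module

theorem differentiableAt_E (h : IsBinormalMotion γ J I) (ht : t ∈ J) (hs : s ∈ I) {i : ℕ}
    (hi : i ∈ Finset.Icc 1 2) : DifferentiableAt ℝ (E γ i) (t, s) := by
  fin_cases hi
  · exact (h.hasFDerivAt_E_one ht hs).differentiableAt
  · obtain ⟨D, hD, -⟩ := h.hasFDerivAt_E_two ht hs
    exact hD.differentiableAt

/-- `frame` counts from 0 and `E` from 1; the only sign is in `E₂ = -I₅`. -/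
theorem E_eq_smul_frame (γ : ℝ → ℝ → ImOctonion) (t s : ℝ) (i : Fin 7) :
    E γ (i + 1) (t, s) = (if i = 1 then -1 else 1 : ℝ) • frame (γ t) s i := by
  fin_cases i <;> simp [E, frame]

theorem orthonormal_E (h : IsBinormalMotion γ J I) (ht : t ∈ J) (hs : s ∈ I) :
    Orthonormal ℝ (fun a : Fin 7 => E γ (a + 1) (t, s)) := by
  rw [orthonormal_iff_ite]
  intro i j
  rw [E_eq_smul_frame, E_eq_smul_frame, real_inner_smul_left, real_inner_smul_right,
    (h.regular t ht).inner_frame hs]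
  split_ifs <;> simp_all

theorem inner_E (h : IsBinormalMotion γ J I) (ht : t ∈ J) (hs : s ∈ I) (i j : Fin 7) :
    ⟪E γ (i + 1) (t, s), E γ (j + 1) (t, s)⟫ = if i = j then 1 else 0 :=
  orthonormal_iff_ite.1 (h.orthonormal_E ht hs) i j

theorem dGamma_apply (h : IsBinormalMotion γ J I) (ht : t ∈ J) (hs : s ∈ I) (X : ℝ × ℝ) :
    dGamma γ (t, s) X = X.2 • E γ 1 (t, s) + (k1 (γ t) s * X.1) • E γ 2 (t, s) := by
  have hX : X = X.1 • ((1, 0) : ℝ × ℝ) + X.2 • ((0, 1) : ℝ × ℝ) := by ext <;> simp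
  conv_lhs => rw [hX]
  rw [map_add, map_smul, map_smul, h.dGamma_snd ht hs, h.dGamma_fst ht hs,
    (h.regular t ht).velocity_eq hs]
  simp only [E]
  module

theorem span_E (h : IsBinormalMotion γ J I) (ht : t ∈ J) (hs : s ∈ I) :
    Submodule.span ℝ {E γ 1 (t, s), E γ 2 (t, s)}
      = LinearMap.range (dGamma γ (t, s)).toLinearMap := by
  have hk := ((h.regular t ht).k1_pos s hs).ne'
  ext x
  rw [Submodule.mem_span_pair, LinearMap.mem_range]
  constructor
  · rintro ⟨a, b, rfl⟩
    refine ⟨((k1 (γ t) s)⁻¹ * b, a), ?_⟩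
    refine (h.dGamma_apply ht hs _).trans ?_
    simp only [mul_inv_cancel_left₀ hk]
  · rintro ⟨X, rfl⟩
    exact ⟨X.2, k1 (γ t) s * X.1, (h.dGamma_apply ht hs X).symm⟩

theorem coframe_one (h : IsBinormalMotion γ J I) (ht : t ∈ J) (hs : s ∈ I) (X : ℝ × ℝ) :
    coframe γ 1 (t, s) X = X.2 := by
  have e1 : ⟪E γ 1 (t, s), E γ 1 (t, s)⟫ = 1 := h.inner_E ht hs 0 0
  have e2 : ⟪E γ 2 (t, s), E γ 1 (t, s)⟫ = 0 := h.inner_E ht hs 1 0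
  rw [coframe, h.dGamma_apply ht hs, inner_add_left, real_inner_smul_left, real_inner_smul_left,
    e1, e2]
  ring

theorem coframe_two (h : IsBinormalMotion γ J I) (ht : t ∈ J) (hs : s ∈ I) (X : ℝ × ℝ) :
    coframe γ 2 (t, s) X = k1 (γ t) s * X.1 := by
  have e1 : ⟪E γ 1 (t, s), E γ 2 (t, s)⟫ = 0 := h.inner_E ht hs 0 1
  have e2 : ⟪E γ 2 (t, s), E γ 2 (t, s)⟫ = 1 := h.inner_E ht hs 1 1
  rw [coframe, h.dGamma_apply ht hs, inner_add_left, real_inner_smul_left, real_inner_smul_left,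
    e1, e2]
  ring

/-- Linearity in `X = ω¹(X) e₁ + ω²(X) e₂`. -/
theorem connForm_eq_sum (h : IsBinormalMotion γ J I) (ht : t ∈ J) (hs : s ∈ I) (i a : ℕ)
    (X : ℝ × ℝ) : connForm γ i a (t, s) X
      = ∑ j ∈ Finset.Icc 1 2, G2Surface.h γ a i j (t, s) * coframe γ j (t, s) X := by
  have hk := ((h.regular t ht).k1_pos s hs).ne'
  have hX : X = (k1 (γ t) s * X.1) • (((k1 (γ t) s)⁻¹, 0) : ℝ × ℝ)
      + X.2 • ((0, 1) : ℝ × ℝ) := by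
    ext
    · simp only [Prod.fst_add, Prod.smul_fst, smul_eq_mul, mul_zero, add_zero]
      field_simp
    · simp
  rw [show Finset.Icc 1 2 = {1, 2} from rfl, Finset.sum_pair (by norm_num),
    h.coframe_one ht hs, h.coframe_two ht hs]
  simp only [G2Surface.h, connForm, e]
  conv_lhs => rw [hX]
  rw [map_add, map_smul, map_smul, inner_add_left, real_inner_smul_left, real_inner_smul_left]
  ring

/-! ### The coefficients in terms of the curve at a fixed time. -/

theorem h_one_one (h : IsBinormalMotion γ J I) (ht : t ∈ J) (hs : s ∈ I) (a : ℕ) :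
    G2Surface.h γ a 1 1 (t, s) = k1 (γ t) s * ⟪I1 (γ t) s, E γ a (t, s)⟫ := by
  rw [G2Surface.h, connForm, (h.hasFDerivAt_E_one ht hs).fderiv]
  change ⟪gammaSS γ (t, s), _⟫ = _
  rw [h.gammaSS_eq ht hs, (h.regular t ht).deriv_I4 hs, real_inner_smul_left]

/-- This is `k₁⁻¹ ⟨v_s, E_a⟩`. The hypothesis removes the tangential term `k₁' I₅`; what remains
agrees with `h_two_one`, which is the symmetry of the form. -/
theorem h_one_two (h : IsBinormalMotion γ J I) (ht : t ∈ J) (hs : s ∈ I) {a : ℕ}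
    (ha : ⟪I5 (γ t) s, E γ a (t, s)⟫ = 0) :
    G2Surface.h γ a 1 2 (t, s) = rho1 (γ t) s * ⟪I1 (γ t) s, E γ a (t, s)⟫
      - kappa2 (γ t) s * ⟪I6 (γ t) s, E γ a (t, s)⟫ := by
  have hk := ((h.regular t ht).k1_pos s hs).ne'
  have hX : e γ 2 (t, s) = (k1 (γ t) s)⁻¹ • ((1, 0) : ℝ × ℝ) := by simp [e]
  rw [G2Surface.h, connForm, (h.hasFDerivAt_E_one ht hs).fderiv, hX, map_smul,
    h.fderiv_gammaS_fst ht hs, ((h.regular t ht).hasDerivAt_velocity hs).deriv,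
    real_inner_smul_left]
  simp only [inner_sub_left, real_inner_smul_left, ha]
  field_simp
  ring

theorem h_two_one (h : IsBinormalMotion γ J I) (ht : t ∈ J) (hs : s ∈ I) (a : ℕ) :
    G2Surface.h γ a 2 1 (t, s) = rho1 (γ t) s * ⟪I1 (γ t) s, E γ a (t, s)⟫
      - kappa2 (γ t) s * ⟪I6 (γ t) s, E γ a (t, s)⟫ := by
  have hd := (h.differentiableAt_E ht hs (i := 2) (by simp)).hasFDerivAt.hasDerivAt_snd
  have h5 := ((h.regular t ht).smooth_I5.hasDerivAt_of_isOpen (h.regular t ht).isOpen hs).neg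
  rw [G2Surface.h, connForm]
  simp only [e]
  rw [hd.unique h5, (h.regular t ht).deriv_I5 hs]
  simp only [inner_neg_left, inner_add_left, real_inner_smul_left]
  ring

theorem h_two_two (h : IsBinormalMotion γ J I) (ht : t ∈ J) (hs : s ∈ I) {a : ℕ}
    (ha : ⟪I5 (γ t) s, E γ a (t, s)⟫ = 0) :
    G2Surface.h γ a 2 2 (t, s) =
      ⟪acceleration (γ t) s, E γ a (t, s)⟫ / k1 (γ t) s ^ 2 := by
  obtain ⟨D, hD, μ, hμ⟩ := h.hasFDerivAt_E_two ht hs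
  have hX : e γ 2 (t, s) = (k1 (γ t) s)⁻¹ • ((1, 0) : ℝ × ℝ) := by simp [e]
  rw [G2Surface.h, connForm, hD.fderiv, hX, map_smul, hμ, real_inner_smul_left, inner_add_left,
    real_inner_smul_left, real_inner_smul_left, ha]
  ring

end IsBinormalMotion

end G2Surface

theorem mainTheorem6
    (J I : Set ℝ) (hJ : IsOpen J) (hI : IsOpen I) (hI' : I.OrdConnected)
    (s₀ : ℝ) (hs₀ : s₀ ∈ I)
    (γ : ℝ → ℝ → ImOctonion)
    (hsmooth : ContDiffOn ℝ ∞ (fun p : ℝ × ℝ => γ p.1 p.2) (J ×ˢ I))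
    (harc : ∀ t ∈ J, ∀ s ∈ I, ‖deriv (γ t) s‖ = 1)
    (hflow : ∀ t ∈ J, ∀ s ∈ I,
      deriv (fun τ => γ τ s) t = ImOctonion.cross (deriv (γ t) s) (deriv (deriv (γ t)) s))
    (hk1 : ∀ t ∈ J, ∀ s ∈ I, 0 < G2Curve.k1 (γ t) s)
    (hkappa2 : ∀ t ∈ J, ∀ s ∈ I, 0 < G2Curve.kappa2 (γ t) s)
    (t : ℝ) (ht : t ∈ J) (s : ℝ) (hs : s ∈ I) :
    let φ₁ : ℝ → ℂ := G2Curve.phi1 (γ t) s₀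
    let φ₂ : ℝ → ℂ := G2Curve.phi2 (γ t) s₀
    let φ₃ : ℝ → ℂ := G2Curve.phi3 (γ t) s₀
    let h : ℕ → ℕ → ℕ → ℝ := fun a i j => G2Surface.h γ a i j (t, s)
    -- the frame is orthonormal, `E₁, E₂` span the tangent plane
    Orthonormal ℝ (fun a : Fin 7 => G2Surface.E γ (a + 1) (t, s)) ∧
    Submodule.span ℝ {G2Surface.E γ 1 (t, s), G2Surface.E γ 2 (t, s)}
      = LinearMap.range (G2Surface.dGamma γ (t, s)).toLinearMap ∧
    -- `ω_i^a = h^a_{ij} ωʲ`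
    (∀ i ∈ Finset.Icc 1 2, ∀ a ∈ Finset.Icc 3 7, ∀ X : ℝ × ℝ,
      G2Surface.connForm γ i a (t, s) X
        = ∑ j ∈ Finset.Icc 1 2, h a i j * G2Surface.coframe γ j (t, s) X) ∧
    -- symmetry
    (∀ a ∈ Finset.Icc 3 7, h a 1 2 = h a 2 1) ∧
    -- the coefficients that may be nonzero
    h 3 1 1 = √2 * ‖φ₁ s‖ ∧
    (h 3 1 2 : ℂ) = Complex.I / 2 * logDeriv (fun x => conj (φ₁ x) / φ₁ x) s ∧
    (h 3 2 2 : ℂ) =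
      -(φ₁ s * conj (deriv (deriv φ₁) s) + conj (φ₁ s) * deriv (deriv φ₁) s)
          / (2 * (√2 : ℝ) * (‖φ₁ s‖ : ℂ) ^ 3)
        + (‖φ₂ s‖ : ℂ) ^ 2 / ((√2 : ℝ) * ‖φ₁ s‖) ∧
    h 4 2 2 =
      -(2 * deriv (fun x => Real.log ‖φ₁ x‖) s * ‖φ₂ s‖ + deriv (fun x => ‖φ₂ x‖) s)
          / (√2 * ‖φ₁ s‖) ∧
    h 5 1 2 = -‖φ₂ s‖ ∧
    (h 5 2 2 : ℂ) =
      -(Complex.I * (2 * logDeriv (fun x => conj (φ₁ x) / φ₁ x) s * (‖φ₂ s‖ : ℂ) ^ 2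
            + φ₂ s * conj (deriv φ₂ s) - conj (φ₂ s) * deriv φ₂ s))
          / (2 * (√2 : ℝ) * ‖φ₁ s‖ * ‖φ₂ s‖) ∧
    (h 6 2 2 : ℂ) =
      (φ₁ s ^ 3 * φ₂ s ^ 2 * φ₃ s + conj (φ₁ s) ^ 3 * conj (φ₂ s) ^ 2 * conj (φ₃ s))
          / (2 * (√2 : ℝ) * (‖φ₁ s‖ : ℂ) ^ 4 * ‖φ₂ s‖) ∧
    (h 7 2 2 : ℂ) =
      Complex.I * (conj (φ₁ s) ^ 3 * conj (φ₂ s) ^ 2 * conj (φ₃ s) - φ₁ s ^ 3 * φ₂ s ^ 2 * φ₃ s)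
          / (2 * (√2 : ℝ) * (‖φ₁ s‖ : ℂ) ^ 4 * ‖φ₂ s‖)
        - 3 * ‖φ₂ s‖ / 2 ∧
    -- all the others vanish
    (h 4 1 1 = 0 ∧ h 5 1 1 = 0 ∧ h 6 1 1 = 0 ∧ h 7 1 1 = 0 ∧
      h 4 1 2 = 0 ∧ h 6 1 2 = 0 ∧ h 7 1 2 = 0) := by
  have hreg : ∀ t ∈ J, G2Curve.IsRegularOn (γ t) I := fun t ht =>
    ⟨hI, hsmooth.comp (contDiffOn_const.prodMk contDiffOn_id) fun x hx => ⟨ht, hx⟩,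
      harc t ht, hk1 t ht, hkappa2 t ht⟩
  have hm : G2Surface.IsBinormalMotion γ J I := ⟨hJ, hsmooth, hreg, hflow⟩
  have hr := hreg t ht
  have hF := hr.inner_frame hs
  have hw : (√2 : ℝ) ≠ 0 := by positivity
  -- For `3 ≤ a ≤ 7` the vector `E_a` is definitionally entry `a - 1` of `frame`, so these inner
  -- products are instances of `hF`.
  have e12 : ∀ a ∈ Finset.Icc 3 7, ⟪G2Curve.I5 (γ t) s, G2Surface.E γ a (t, s)⟫ = 0 := by
    intro a ha
    fin_cases ha
    exacts [hF 1 2, hF 1 3, hF 1 4, hF 1 5, hF 1 6]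
  have h11 : ∀ a ∈ Finset.Icc 4 7, ⟪G2Curve.I1 (γ t) s, G2Surface.E γ a (t, s)⟫ = 0 := by
    intro a ha
    fin_cases ha
    exacts [hF 2 3, hF 2 4, hF 2 5, hF 2 6]
  have e11 : ⟪G2Curve.I1 (γ t) s, G2Surface.E γ 3 (t, s)⟫ = 1 := hF 2 2
  have e63 : ⟪G2Curve.I6 (γ t) s, G2Surface.E γ 3 (t, s)⟫ = 0 := hF 4 2
  have e64 : ⟪G2Curve.I6 (γ t) s, G2Surface.E γ 4 (t, s)⟫ = 0 := hF 4 3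
  have e65 : ⟪G2Curve.I6 (γ t) s, G2Surface.E γ 5 (t, s)⟫ = 1 := hF 4 4
  have e66 : ⟪G2Curve.I6 (γ t) s, G2Surface.E γ 6 (t, s)⟫ = 0 := hF 4 5
  have e67 : ⟪G2Curve.I6 (γ t) s, G2Surface.E γ 7 (t, s)⟫ = 0 := hF 4 6
  intro φ₁ φ₂ φ₃ h
  have h1 : ∀ a, h a 1 1 = _ := fun a => hm.h_one_one ht hs a
  have h2 : ∀ a ∈ Finset.Icc 3 7, h a 1 2 = _ := fun a ha => hm.h_one_two ht hs (e12 a ha)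
  have h3 : ∀ a ∈ Finset.Icc 3 7, h a 2 1 = _ := fun a _ => hm.h_two_one ht hs a
  have h4 : ∀ a ∈ Finset.Icc 3 7, h a 2 2 = _ := fun a ha => hm.h_two_two ht hs (e12 a ha)
  refine ⟨hm.orthonormal_E ht hs, hm.span_E ht hs, fun i _ a _ X => hm.connForm_eq_sum ht hs i a X,
    fun a ha => (h2 a ha).trans (h3 a ha).symm, ?_, ?_, ?_, ?_, ?_, ?_, ?_, ?_,
    ?_, ?_, ?_, ?_, ?_, ?_, ?_⟩
  · rw [h1, e11, G2Curve.norm_phi1]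
    field_simp
  · rw [h2 3 (by simp), e11, e63, hr.logDeriv_conj_phi1_div hI' hs₀ hs]
    push_cast
    linear_combination (G2Curve.rho1 (γ t) s) * Complex.I_sq
  · rw [h4 3 (by simp), hr.second_fundamental_322 hI' hs₀ hs]
    exact_mod_cast congrArg (· / G2Curve.k1 (γ t) s ^ (2 : ℕ)) (hr.inner_acceleration_I1 hs)
  · rw [h4 4 (by simp), hr.second_fundamental_422 hs]
    exact congrArg (· / G2Curve.k1 (γ t) s ^ (2 : ℕ)) (hr.inner_acceleration_I2 hs)
  · rw [h2 5 (by simp), h11 5 (by simp), e65, G2Curve.norm_phi2]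
    ring
  · rw [h4 5 (by simp), hr.second_fundamental_522 hI' hs₀ hs]
    exact_mod_cast congrArg (· / G2Curve.k1 (γ t) s ^ (2 : ℕ)) (hr.inner_acceleration_I6 hs)
  · rw [h4 6 (by simp), hr.second_fundamental_622 hs]
    exact_mod_cast congrArg (· / G2Curve.k1 (γ t) s ^ (2 : ℕ)) (hr.inner_acceleration_I3 hs)
  · rw [h4 7 (by simp), hr.second_fundamental_722 hs]
    exact_mod_cast congrArg (· / G2Curve.k1 (γ t) s ^ (2 : ℕ)) (hr.inner_acceleration_I7 hs)
  · rw [h1, h11 4 (by simp), mul_zero]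
  · rw [h1, h11 5 (by simp), mul_zero]
  · rw [h1, h11 6 (by simp), mul_zero]
  · rw [h1, h11 7 (by simp), mul_zero]
  · rw [h2 4 (by simp), h11 4 (by simp), e64]
    ring
  · rw [h2 6 (by simp), h11 6 (by simp), e66]
    ring
  · rw [h2 7 (by simp), h11 7 (by simp), e67]
    ring
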